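/- Theorem 6 (convergence of the gradient-perturbation algorithm, "Algorithm 2"). Let $n\ge 1$ agents be given, and for each agent $i$ a data distribution $\mathcal D_i$, an integrable cost $\ell_i(x,\xi_i)$, $\xi_i\sim\mathcal D_i$, and $f_i(x)=\mathbb E_{\xi_i\sim\mathcal D_i}[\ell_i(x,\xi_i)]$ for $x\in\mathbb R^d$; put $f=\sum_{i=1}^n f_i$. Assume: 1. (Costs) Each $f_i$ is differentiable and there are constants $L_i>0$ and $\mu>0$ such that $\|\nabla f_i(x)-\nabla f_i(y)\|\le L_i\|x-y\|$ and $\langle\nabla f_i(x)-\nabla f_i(y),x-y\rangle\ge\mu\|x-y\|^2$ for all $x,y\in\mathbb R^d$ and all $i$. Put $L^2=\sum_{i=1}^n L_i^2$. 2. (Sampled gradients) There is $\sigma_g>0$ such that the (jointly measurable) sampled gradients $g_i(x,\xi_i)$ satisfy $\mathbb E[g_i(x,\xi_i)]=\nabla f_i(x)$ and $\mathbb E\|g_i(x,\xi_i)-\nabla f_i(x)\|^2\le\sigma_g^2$ for every $x\in\mathbb R^d$ and every $i$. 3. (Network) The agents communicate over a connected undirected graph; $\mathcal N_i$ is the set of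 neighbours of $i$, including $i$ itself. The matrix $A=[a_{ij}]\in\mathbb R^{n\times n}$ is doubly stochastic, and for some $\eta>0$ one has $a_{ij}>\eta$ for $j\in\mathcal N_i$ and $a_{ij}=0$ for $j\notin\mathcal N_i$. Let $\sigma_2$ be the second largest singular value of $A$ (with $\sigma_2=0$ if $n=1$). 4. (Step sizes, noise parameters, sample sizes) $\alpha_k>0$, $0<\beta_k<1$, $\sigma_k>0$ and integers $\gamma_k\ge1$ $(k\ge0)$ satisfy $$\sup_k\frac{\alpha_k}{\beta_k}\le\min\Big\{\frac{2(1-\sigma_2)}{3\mu},\ \frac{(1-\sigma_2)^2\mu^2\beta_0}{16\,(6L^2\alpha_0+n(1-\sigma_2)\mu\beta_0)(\beta_0+1)L^2}\Big\},$$ $$\sum_k\frac{\alpha_k^2}{\beta_k}<\infty,\quad\sum_k\frac{\alpha_k^2}{\gamma_k\beta_k}<\infty,\quad\sum_k\frac{\alpha_k^2\sigma_k^2}{\beta_k}<\infty,\quad\sum_k\frac{\alpha_k^2}{\gamma_k}<\infty,\quad\sum_k\alpha_k^2\sigma_k^2<\infty,$$ and $\sum_k\alpha_k=\infty$. From arbitrary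 initial values $x_{i,0}\in\mathbb R^d$ each agent iterates $$x_{i,k+1}=(1-\beta_k)x_{i,k}+\beta_k\sum_{j\in\mathcal N_i}a_{ij}x_{j,k}-\alpha_k\Big(\frac1{\gamma_k}\sum_{l=1}^{\gamma_k}g_i(x_{i,k},\xi_{i,k}^l)+n_{i,k}\Big).$$ Here the samples $\xi_{i,k}^l$ have law $\mathcal D_i$; for each agent and iteration the samples are independent over $l$, and the samples of different iterations are independent. The privacy noises $n_{i,k}\in\mathbb R^d$ are independent over all agents and iterations and independent of the samples, and every component of $n_{i,k}$ has the zero-mean Laplace distribution with variance $2\sigma_k^2$. Then there is a minimizer $x^*$ of $f$ over $\mathbb R^d$ such that, for every agent $i$, $\lim_{k\to\infty}\mathbb E\|x_{i,k}-x^*\|^2=0$ (all these expectations being finite) and $\lim_{k\to\infty}x_{i,k}=x^*$ almost surely. -/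

import Mathlib

open MeasureTheory ProbabilityTheory Filter Topology
open scoped Gradient RealInnerProductSpace

noncomputable section

namespace GradPerturb

/-- The decision space `ℝ^d` with its Euclidean norm. -/
abbrev E (d : ℕ) : Type := EuclideanSpace ℝ (Fin d)

section Problem

variable {n d : ℕ} {Ξ : Fin n → Type*} [∀ i, MeasurableSpace (Ξ i)]

/-- The local cost `f_i(x) = 𝔼[ℓ_i(x, ξ_i)]`, `ξ_i ∼ D_i`. -/
def localCost (ℓ : ∀ i, E d → Ξ i → ℝ) (D : ∀ i, Measure (Ξ i)) (i : Fin n) (x : E d) : ℝ :=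
  ∫ s, ℓ i x s ∂(D i)

/-- The global cost `f(x) = ∑ i, f_i(x)`. -/
def globalCost (ℓ : ∀ i, E d → Ξ i → ℝ) (D : ∀ i, Measure (Ξ i)) (x : E d) : ℝ :=
  ∑ i, localCost ℓ D i x

/-- The local costs are differentiable with `L_i`-Lipschitz gradients and are
`μ`-strongly convex. -/
structure SmoothStronglyConvex (f : Fin n → E d → ℝ) (L : Fin n → ℝ) (μ : ℝ) : Prop where
  differentiable : ∀ i, Differentiable ℝ (f i)
  lipschitz_pos : ∀ i, 0 < L i
  lipschitz : ∀ i x y, ‖∇ (f i) x - ∇ (f i) y‖ ≤ L i * ‖x - y‖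
  convexity_pos : 0 < μ
  strongly_convex : ∀ i x y, μ * ‖x - y‖ ^ 2 ≤ ⟪∇ (f i) x - ∇ (f i) y, x - y⟫

/-- The sampled gradients `g_i(x, ξ_i)` are unbiased estimates of `∇ f_i(x)` with variance
at most `σ_g²`. -/
structure UnbiasedBoundedVariance (g : ∀ i, E d → Ξ i → E d) (D : ∀ i, Measure (Ξ i))
    (f : Fin n → E d → ℝ) (σg : ℝ) : Prop where
  measurable : ∀ i, Measurable (fun p : E d × Ξ i => g i p.1 p.2)
  integrable : ∀ i x, Integrable (g i x) (D i)
  unbiased : ∀ i x, ∫ s, g i x s ∂(D i) = ∇ (f i) x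
  const_pos : 0 < σg
  integrable_sq : ∀ i x, Integrable (fun s => ‖g i x s - ∇ (f i) x‖ ^ 2) (D i)
  variance_le : ∀ i x, ∫ s, ‖g i x s - ∇ (f i) x‖ ^ 2 ∂(D i) ≤ σg ^ 2

end Problem

section Network

variable {n : ℕ}

open Classical in
/-- The neighbourhood of agent `i`, including `i` itself. -/
def nbhd (G : SimpleGraph (Fin n)) (i : Fin n) : Finset (Fin n) :=
  Finset.univ.filter fun j => j = i ∨ G.Adj j i

/-- The undirected communication graph is connected, and the adjacency (weight) matrix is
supported exactly on the neighbourhoods, uniformly positive there, and doubly stochastic. -/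
structure ConnectedDoublyStochastic (G : SimpleGraph (Fin n)) (A : Matrix (Fin n) (Fin n) ℝ) :
    Prop where
  connected : G.Connected
  weights : ∃ η : ℝ, 0 < η ∧
    ∀ i j, (j ∈ nbhd G i → η < A i j) ∧ (j ∉ nbhd G i → A i j = 0)
  doubly_stochastic : A ∈ doublyStochastic ℝ (Fin n)

/-- The second largest singular value of `A` (singular values are indexed from `0`, listed in
decreasing order with multiplicity; the value is `0` for a `1 × 1` matrix). -/
def secondSingularValue (A : Matrix (Fin n) (Fin n) ℝ) : ℝ :=
  (Matrix.toEuclideanLin A).singularValues 1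

end Network

section Algorithm

variable {n d : ℕ} {Ξ : Fin n → Type*} {Ω : Type*}

/-- The iterates of the gradient-perturbation algorithm, started at `x₀`:
`x_{i,k+1} = (1 - β_k) x_{i,k} + β_k ∑_{j ∈ N_i} a_{ij} x_{j,k} - α_k (g_i^k + n_{i,k})`, where
`g_i^k = (1/γ_k) ∑_{l} g_i(x_{i,k}, ξ_{i,k}^l)` is the average of `γ_k` sampled gradients. -/
def iterate (G : SimpleGraph (Fin n)) (A : Matrix (Fin n) (Fin n) ℝ)
    (g : ∀ i, E d → Ξ i → E d) (α β : ℕ → ℝ) (γ : ℕ → ℕ) (x₀ : Fin n → E d)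
    (ξ : ∀ (i : Fin n) (k : ℕ), Fin (γ k) → Ω → Ξ i) (N : Fin n → ℕ → Ω → E d) :
    ℕ → Fin n → Ω → E d
  | 0, i, _ => x₀ i
  | k + 1, i, ω =>
      (1 - β k) • iterate G A g α β γ x₀ ξ N k i ω
        + β k • ∑ j ∈ nbhd G i, A i j • iterate G A g α β γ x₀ ξ N k j ω
        - α k • ((γ k : ℝ)⁻¹ • ∑ l, g i (iterate G A g α β γ x₀ ξ N k i ω) (ξ i k l ω)
            + N i k ω)

/-- The centred Laplace distribution with scale `b`, i.e. with density `exp(-|t|/b) / (2b)`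
(and hence variance `2 b²`). -/
def laplaceLaw (b : ℝ) : Measure ℝ :=
  volume.withDensity fun t => ENNReal.ofReal (Real.exp (-|t| / b) / (2 * b))

/-- The randomness of the algorithm. The sample `ξ_{i,k}^l` has law `D_i`; for each agent the
samples are independent within an iteration, and the samples of different iterations are
independent (samples of different agents at the same iteration may be dependent). The noise
vectors `n_{i,k}` are independent over agents and time, their components are Laplace with
variance `2 σ_k²`, and they are independent of the samples. -/
structure SamplesAndNoise [MeasurableSpace Ω] [∀ i, MeasurableSpace (Ξ i)] (P : Measure Ω)
    (D : ∀ i, Measure (Ξ i)) (σ : ℕ → ℝ) (γ : ℕ → ℕ)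
    (ξ : ∀ (i : Fin n) (k : ℕ), Fin (γ k) → Ω → Ξ i) (N : Fin n → ℕ → Ω → E d) : Prop where
  sample_measurable : ∀ i k l, Measurable (ξ i k l)
  sample_law : ∀ i k l, P.map (ξ i k l) = D i
  sample_indep_within : ∀ i k, iIndepFun (fun l => ξ i k l) P
  sample_indep_time :
    iIndepFun (fun (k : ℕ) (ω : Ω) (i : Fin n) (l : Fin (γ k)) => ξ i k l ω) P
  noise_measurable : ∀ i k, Measurable (N i k)
  noise_law : ∀ i k (c : Fin d), P.map (fun ω => N i k ω c) = laplaceLaw (σ k)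
  noise_indep : iIndepFun (fun (p : Fin n × ℕ) => N p.1 p.2) P
  sample_indep_noise :
    IndepFun (fun ω (i : Fin n) (k : ℕ) (l : Fin (γ k)) => ξ i k l ω)
      (fun ω (i : Fin n) (k : ℕ) => N i k ω) P

/-- The ranges of the step sizes, noise parameters and sample sizes. -/
structure AdmissibleParameters (α β σ : ℕ → ℝ) (γ : ℕ → ℕ) : Prop where
  step_pos : ∀ k, 0 < α k
  weight_mem : ∀ k, 0 < β k ∧ β k < 1
  noise_pos : ∀ k, 0 < σ k
  sample_pos : ∀ k, 0 < γ k

/-- The two-time-scale conditions on step sizes, noise parameters and sample sizes; here `σ₂` is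
the second largest singular value of the weight matrix and `Lsq = ∑ i, L_i²`. -/
structure StepSizeConditions (n : ℕ) (σ₂ μ Lsq : ℝ) (α β σ : ℕ → ℝ) (γ : ℕ → ℕ) : Prop where
  ratio_le : ∀ k, α k / β k ≤
    min (2 * (1 - σ₂) / (3 * μ))
      ((1 - σ₂) ^ 2 * μ ^ 2 * β 0 /
        (16 * (6 * Lsq * α 0 + n * (1 - σ₂) * μ * β 0) * (β 0 + 1) * Lsq))
  summable_ratio : Summable fun k => α k ^ 2 / β k
  summable_sample_ratio : Summable fun k => α k ^ 2 / (γ k * β k)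
  summable_noise_ratio : Summable fun k => α k ^ 2 * σ k ^ 2 / β k
  summable_sample : Summable fun k => α k ^ 2 / γ k
  summable_noise : Summable fun k => α k ^ 2 * σ k ^ 2

end Algorithm

end GradPerturb

end

open GradPerturb

open MeasureTheory ProbabilityTheory Filter Topology
open scoped Gradient RealInnerProductSpace

namespace GradPerturb

section Consensus

variable {n d : ℕ}

lemma toEuclideanLin_one {A : Matrix (Fin n) (Fin n) ℝ} (hA : A ∈ doublyStochastic ℝ (Fin n)) :
    Matrix.toEuclideanLin A (WithLp.toLp 2 1) = WithLp.toLp 2 1 := by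
  rw [mem_doublyStochastic] at hA
  simp [Matrix.toLpLin_apply, hA.2.1]

lemma adjoint_comp_toEuclideanLin_one {A : Matrix (Fin n) (Fin n) ℝ}
    (hA : A ∈ doublyStochastic ℝ (Fin n)) :
    (LinearMap.adjoint (Matrix.toEuclideanLin A) ∘ₗ Matrix.toEuclideanLin A) (WithLp.toLp 2 1)
      = WithLp.toLp 2 1 := by
  rw [LinearMap.comp_apply, toEuclideanLin_one hA, ← Matrix.toEuclideanLin_conjTranspose_eq_adjoint]
  refine toEuclideanLin_one ?_
  rw [mem_doublyStochastic_iff_sum] at hA ⊢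
  exact ⟨fun i j => hA.1 j i, hA.2.2, hA.2.1⟩

/-- A doubly stochastic matrix contracts the orthogonal complement of the consensus space by its
second largest singular value, when that value is less than one. -/
lemma norm_toEuclideanLin_sq_le {A : Matrix (Fin n) (Fin n) ℝ}
    (hA : A ∈ doublyStochastic ℝ (Fin n)) (hσ : secondSingularValue A < 1)
    (v : EuclideanSpace ℝ (Fin n)) (hv : ∑ i, v i = 0) :
    ‖Matrix.toEuclideanLin A v‖ ^ 2 ≤ secondSingularValue A ^ 2 * ‖v‖ ^ 2 := by
  rcases n with _ | m
  · have : v = 0 := Subsingleton.elim _ _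
    simp [this]
  set T := Matrix.toEuclideanLin A with hT
  have hn : Module.finrank ℝ (EuclideanSpace ℝ (Fin (m + 1))) = m + 1 := by simp
  have hS := T.isSymmetric_adjoint_comp_self
  set b := hS.eigenvectorBasis hn with hb
  set ev := hS.eigenvalues hn with hev
  set one : EuclideanSpace ℝ (Fin (m + 1)) := WithLp.toLp 2 1 with hone
  have hSone : (LinearMap.adjoint T ∘ₗ T) one = one := adjoint_comp_toEuclideanLin_one hA
  have hSb (j) : (LinearMap.adjoint T ∘ₗ T) (b j) = ev j • b j :=
    hS.apply_eigenvectorBasis hn j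
  have hev_le (j : Fin (m + 1)) (hj : j ≠ 0) : ev j ≤ secondSingularValue A ^ 2 := by
    have hj1 : 1 ≤ (j : ℕ) := Nat.one_le_iff_ne_zero.2 fun h => hj (Fin.ext h)
    rw [hev, ← T.sq_singularValues_fin hn j]
    exact pow_le_pow_left₀ (T.singularValues_nonneg _) (T.singularValues_antitone hj1) 2
  have hσ0 : 0 ≤ secondSingularValue A := T.singularValues_nonneg 1
  have hev_lt (j : Fin (m + 1)) (hj : j ≠ 0) : ev j < 1 :=
    (hev_le j hj).trans_lt (by nlinarith)
  have horth (j : Fin (m + 1)) (hj : j ≠ 0) : ⟪b j, one⟫ = 0 := by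
    have h := hS (b j) one
    rw [hSb, hSone, inner_smul_left] at h
    have := hev_lt j hj
    have h' : (ev j - 1) * ⟪b j, one⟫ = 0 := by
      simp only [conj_trivial] at h
      linarith
    exact (mul_eq_zero.1 h').resolve_left (by linarith)
  have hone0 : one = ⟪b 0, one⟫ • b 0 := by
    conv_lhs => rw [← b.sum_repr' one]
    exact Finset.sum_eq_single 0 (fun j _ hj => by rw [horth j hj, zero_smul]) (by simp)
  have hvone : ⟪one, v⟫ = 0 := by
    simpa [hone, PiLp.inner_apply] using hv
  have hv0 : ⟪b 0, v⟫ = 0 := by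
    rw [hone0, inner_smul_left] at hvone
    refine (mul_eq_zero.1 hvone).resolve_left fun h => ?_
    have h0 : one = 0 := by
      rw [hone0]; simp only [conj_trivial] at h; rw [h, zero_smul]
    have := congrArg (fun w : EuclideanSpace ℝ (Fin (m + 1)) => w 0) h0
    simp [hone] at this
  have key : ‖T v‖ ^ 2 = ∑ j, ev j * ⟪b j, v⟫ ^ 2 := by
    rw [← real_inner_self_eq_norm_sq, ← LinearMap.adjoint_inner_right, ← LinearMap.comp_apply,
      ← b.sum_inner_mul_inner]
    refine Finset.sum_congr rfl fun j _ => ?_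
    rw [← hS (b j) v, hSb, inner_smul_left, real_inner_comm v]
    simp only [conj_trivial]
    ring
  rw [key, ← b.sum_sq_norm_inner_right v, Finset.mul_sum]
  refine Finset.sum_le_sum fun j _ => ?_
  rw [Real.norm_eq_abs, sq_abs]
  rcases eq_or_ne j 0 with rfl | hj
  · simp [hv0]
  · exact mul_le_mul_of_nonneg_right (hev_le j hj) (sq_nonneg _)

lemma sum_norm_mix_sq_le {A : Matrix (Fin n) (Fin n) ℝ}
    (hA : A ∈ doublyStochastic ℝ (Fin n)) (hσ : secondSingularValue A < 1)
    (y : Fin n → E d) (hy : ∑ i, y i = 0) :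
    ∑ i, ‖∑ j, A i j • y j‖ ^ 2 ≤ secondSingularValue A ^ 2 * ∑ i, ‖y i‖ ^ 2 := by
  simp_rw [EuclideanSpace.norm_sq_eq, Finset.mul_sum]
  rw [Finset.sum_comm, Finset.sum_comm (s := Finset.univ (α := Fin n))]
  refine Finset.sum_le_sum fun c _ => ?_
  have h := norm_toEuclideanLin_sq_le hA hσ (WithLp.toLp 2 fun i => y i c) (by
    simpa using congrArg (fun w : E d => w c) hy)
  simpa [EuclideanSpace.norm_sq_eq, Matrix.toLpLin_apply, Matrix.mulVec, dotProduct,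
    Finset.mul_sum] using h

end Consensus

section Independence

variable {Ω 𝓧 𝓔 : Type*} {m mΩ : MeasurableSpace Ω} [MeasurableSpace 𝓧] [MeasurableSpace 𝓔]
  {P : Measure Ω} [IsProbabilityMeasure P] {X : Ω → 𝓧} {η : Ω → 𝓔} {S : Set Ω}

lemma map_mem_prod_eq_of_indep (hm : m ≤ mΩ) (hX : Measurable[m] X) (hη : Measurable η)
    (hind : Indep m (MeasurableSpace.comap η inferInstance) P) (hS : MeasurableSet[m] S) :
    P.map (fun ω => ((X ω, ω ∈ S), η ω))
      = (P.map fun ω => (X ω, ω ∈ S)).prod (P.map η) := by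
  have hY : Measurable[m] fun ω => (X ω, ω ∈ S) :=
    Measurable.prodMk (m := m) hX (@MeasurableSet.mem Ω S m hS)
  refine (indepFun_iff_map_prod_eq_prod_map_map (hY.mono hm le_rfl).aemeasurable
    hη.aemeasurable).1 ?_
  exact indep_of_indep_of_le_left hind hY.comap_le

open Classical in
/-- Freezing lemma for nonnegative functions: an independent variable can be integrated out. -/
lemma setLIntegral_comp_of_indep (hm : m ≤ mΩ) (hX : Measurable[m] X) (hη : Measurable η)
    (hind : Indep m (MeasurableSpace.comap η inferInstance) P) (hS : MeasurableSet[m] S)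
    {h : 𝓧 → 𝓔 → ENNReal} (hh : Measurable fun p : 𝓧 × 𝓔 => h p.1 p.2) :
    ∫⁻ ω in S, h (X ω) (η ω) ∂P = ∫⁻ ω in S, ∫⁻ ω', h (X ω) (η ω') ∂P ∂P := by
  have hY : Measurable fun ω => (X ω, ω ∈ S) :=
    (hX.mono hm le_rfl).prodMk (hm S hS).mem
  set H : (𝓧 × Prop) × 𝓔 → ENNReal := fun q => if q.1.2 then h q.1.1 q.2 else 0 with hH
  have hHm : Measurable H := by
    refine Measurable.ite ?_ (hh.comp ((measurable_fst.comp measurable_fst).prodMk measurable_snd)) measurable_const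
    exact (measurable_snd.comp measurable_fst).setOf
  have h1 : ∫⁻ ω in S, h (X ω) (η ω) ∂P = ∫⁻ q, H q ∂(P.map fun ω => ((X ω, ω ∈ S), η ω)) := by
    rw [lintegral_map hHm (hY.prodMk hη), ← lintegral_indicator (hm S hS)]
    rfl
  rw [h1, map_mem_prod_eq_of_indep hm hX hη hind hS, lintegral_prod _ hHm.aemeasurable,
    lintegral_map hHm.lintegral_prod_right' hY, ← lintegral_indicator (hm S hS)]
  refine lintegral_congr fun ω => ?_
  rw [lintegral_map (f := fun y => H ((X ω, ω ∈ S), y)) (hHm.comp measurable_prodMk_left) hη]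
  by_cases hω : ω ∈ S <;> simp [hH, hω]

open Classical in
/-- Freezing lemma for integrable functions. -/
lemma setIntegral_comp_of_indep (hm : m ≤ mΩ) (hX : Measurable[m] X) (hη : Measurable η)
    (hind : Indep m (MeasurableSpace.comap η inferInstance) P) (hS : MeasurableSet[m] S)
    {h : 𝓧 → 𝓔 → ℝ} (hh : Measurable fun p : 𝓧 × 𝓔 => h p.1 p.2)
    (hint : Integrable (fun ω => h (X ω) (η ω)) P) :
    ∫ ω in S, h (X ω) (η ω) ∂P = ∫ ω in S, ∫ ω', h (X ω) (η ω') ∂P ∂P := by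
  have hY : Measurable fun ω => (X ω, ω ∈ S) :=
    (hX.mono hm le_rfl).prodMk (hm S hS).mem
  set H : (𝓧 × Prop) × 𝓔 → ℝ := fun q => if q.1.2 then h q.1.1 q.2 else 0 with hH
  have hHm : Measurable H := by
    refine Measurable.ite ?_ (hh.comp ((measurable_fst.comp measurable_fst).prodMk measurable_snd)) measurable_const
    exact (measurable_snd.comp measurable_fst).setOf
  have hcomp : (fun ω => H ((X ω, ω ∈ S), η ω)) = S.indicator fun ω => h (X ω) (η ω) := rfl
  have h1 : ∫ ω in S, h (X ω) (η ω) ∂P = ∫ q, H q ∂(P.map fun ω => ((X ω, ω ∈ S), η ω)) := by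
    rw [integral_map (hY.prodMk hη).aemeasurable hHm.aestronglyMeasurable,
      ← integral_indicator (hm S hS), hcomp]
  have hHint : Integrable H (P.map fun ω => ((X ω, ω ∈ S), η ω)) := by
    rw [integrable_map_measure hHm.aestronglyMeasurable (hY.prodMk hη).aemeasurable]
    exact hint.indicator (hm S hS)
  rw [map_mem_prod_eq_of_indep hm hX hη hind hS] at h1 hHint
  have hsm : StronglyMeasurable fun y => ∫ e, H (y, e) ∂(P.map η) :=
    hHm.stronglyMeasurable.integral_prod_right'
  rw [h1, integral_prod _ hHint, integral_map hY.aemeasurable hsm.aestronglyMeasurable,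
    ← integral_indicator (hm S hS)]
  refine integral_congr_ae (ae_of_all _ fun ω => ?_)
  simp only []
  rw [integral_map (f := fun y => H ((X ω, ω ∈ S), y)) hη.aemeasurable
    (hHm.comp measurable_prodMk_left).aestronglyMeasurable]
  by_cases hω : ω ∈ S <;> simp [hH, hω]

end Independence

section SumIndependence

variable {Ω ι κ : Type*} {mΩ : MeasurableSpace Ω} {P : Measure Ω}

/-- Two independent families of σ-algebras, each dominated by one of two independent σ-algebras,
form together an independent family. -/
lemma iIndep_sumElim {m₁ : ι → MeasurableSpace Ω} {m₂ : κ → MeasurableSpace Ω}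
    {M₁ M₂ : MeasurableSpace Ω} (h₁ : iIndep m₁ P) (h₂ : iIndep m₂ P) (h : Indep M₁ M₂ P)
    (hle₁ : ∀ i, m₁ i ≤ M₁) (hle₂ : ∀ j, m₂ j ≤ M₂) : iIndep (Sum.elim m₁ m₂) P := by
  rw [iIndep_iff] at h₁ h₂ ⊢
  rw [Indep_iff] at h
  intro s f hf
  have e : ⋂ i ∈ s, f i = (⋂ i ∈ s.toLeft, f (Sum.inl i)) ∩ ⋂ j ∈ s.toRight, f (Sum.inr j) := by
    ext ω
    simp
  have hl (i) (hi : i ∈ s.toLeft) : MeasurableSet[m₁ i] (f (Sum.inl i)) :=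
    hf _ (Finset.mem_toLeft.1 hi)
  have hr (j) (hj : j ∈ s.toRight) : MeasurableSet[m₂ j] (f (Sum.inr j)) :=
    hf _ (Finset.mem_toRight.1 hj)
  rw [e, h _ _ (Finset.measurableSet_biInter _ fun i hi => hle₁ i _ (hl i hi))
    (Finset.measurableSet_biInter _ fun j hj => hle₂ j _ (hr j hj)),
    h₁ _ (f := fun i => f (Sum.inl i)) hl, h₂ _ (f := fun j => f (Sum.inr j)) hr]
  conv_rhs => rw [← Finset.toLeft_disjSum_toRight (u := s), Finset.prod_disjSum]

end SumIndependence

section Average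

lemma integrable_inner_of_memLp {Ω : Type*} {mΩ : MeasurableSpace Ω} {P : Measure Ω} {d : ℕ}
    {X Y : Ω → E d} (hX : MemLp X 2 P) (hY : MemLp Y 2 P) :
    Integrable (fun ω => ⟪X ω, Y ω⟫) P :=
  (hX.norm.integrable_mul hY.norm).mono'
    (hX.aestronglyMeasurable.inner hY.aestronglyMeasurable)
    (ae_of_all _ fun ω => norm_inner_le_norm (X ω) (Y ω))

variable {Ω : Type*} {mΩ : MeasurableSpace Ω} {P : Measure Ω} [IsProbabilityMeasure P] {d : ℕ}

lemma integral_inner_eq_zero_of_indepFun {X Y : Ω → E d} (hXY : IndepFun X Y P)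
    (hX : MemLp X 2 P) (hY : MemLp Y 2 P) (hY0 : ∫ ω, Y ω ∂P = 0) :
    ∫ ω, ⟪X ω, Y ω⟫ ∂P = 0 := by
  have : ∫ ω, ⟪X ω, Y ω⟫ ∂P = ⟪∫ ω, X ω ∂P, ∫ ω, Y ω ∂P⟫ :=
    hXY.integral_bilin (hX.integrable one_le_two) (hY.integrable one_le_two) (innerSL ℝ)
  rw [this, hY0, inner_zero_right]

/-- The variance of an average of `γ` independent centred vectors is at most `1 / γ` times the
common bound of their variances. -/
lemma integral_norm_average_sq_le {γ : ℕ} (hγ : 0 < γ) {Y : Fin γ → Ω → E d} {v : ℝ}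
    (hind : Pairwise fun l l' => IndepFun (Y l) (Y l') P) (hY : ∀ l, MemLp (Y l) 2 P)
    (h0 : ∀ l, ∫ ω, Y l ω ∂P = 0) (hv : ∀ l, ∫ ω, ‖Y l ω‖ ^ 2 ∂P ≤ v) :
    ∫ ω, ‖(γ : ℝ)⁻¹ • ∑ l, Y l ω‖ ^ 2 ∂P ≤ v / γ := by
  have hint (l l') : Integrable (fun ω => ⟪Y l ω, Y l' ω⟫) P :=
    integrable_inner_of_memLp (hY l) (hY l')
  have e (ω) : ‖(γ : ℝ)⁻¹ • ∑ l, Y l ω‖ ^ 2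
      = ((γ : ℝ)⁻¹) ^ 2 * ∑ l, ∑ l', ⟪Y l ω, Y l' ω⟫ := by
    rw [norm_smul, mul_pow, Real.norm_eq_abs, sq_abs, ← real_inner_self_eq_norm_sq, sum_inner]
    simp_rw [inner_sum]
  simp_rw [e]
  rw [integral_const_mul, integral_finsetSum _ fun l _ => integrable_finsetSum _ fun l' _ => hint l l']
  have hl (l : Fin γ) : ∫ ω, ∑ l', ⟪Y l ω, Y l' ω⟫ ∂P ≤ v := by
    rw [integral_finsetSum _ fun l' _ => hint l l',
      Finset.sum_eq_single l (fun l' _ hl' => integral_inner_eq_zero_of_indepFun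
        (hind hl'.symm) (hY l) (hY l') (h0 l')) (by simp)]
    simpa only [real_inner_self_eq_norm_sq] using hv l
  calc _ ≤ ((γ : ℝ)⁻¹) ^ 2 * ∑ _l : Fin γ, v := by gcongr with l; exact hl l
    _ = v / γ := by
        have : (γ : ℝ) ≠ 0 := by positivity
        simp; field_simp

end Average

section AlmostSupermartingale

lemma sum_range_le_tsum_sub {t : ℕ → ℝ} (ht : ∀ k, 0 ≤ t k) (hts : Summable t) (k : ℕ) :
    0 ≤ ∑' j, t j - ∑ j ∈ Finset.range k, t j :=
  sub_nonneg.2 (hts.sum_le_tsum _ fun j _ => ht j)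

lemma tendsto_zero_of_le_one_sub_mul_add {v α t : ℕ → ℝ} {κ : ℝ} (hκ : 0 < κ)
    (hv : ∀ k, 0 ≤ v k) (hα : ∀ k, 0 ≤ α k) (ht : ∀ k, 0 ≤ t k) (hts : Summable t)
    (hdiv : Tendsto (fun K : ℕ => ∑ k ∈ Finset.range K, α k) atTop atTop)
    (h : ∀ k, v (k + 1) ≤ (1 - κ * α k) * v k + t k) : Tendsto v atTop (𝓝 0) := by
  set y : ℕ → ℝ := fun k => v k + (∑' j, t j - ∑ j ∈ Finset.range k, t j) with hy
  have hstep (k) : y (k + 1) ≤ y k - κ * (α k * v k) := by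
    simp only [hy, Finset.sum_range_succ]
    linarith [h k]
  have hprod (k) : 0 ≤ α k * v k := mul_nonneg (hα k) (hv k)
  have hy0 (k) : 0 ≤ y k := add_nonneg (hv k) (sum_range_le_tsum_sub ht hts k)
  have hanti : Antitone y := antitone_nat_of_succ_le fun k => by
    have := mul_nonneg hκ.le (hprod k)
    linarith [hstep k]
  have hlim := tendsto_atTop_ciInf hanti ⟨0, by rintro _ ⟨k, rfl⟩; exact hy0 k⟩
  set l := ⨅ k, y k
  have htail : Tendsto (fun k => ∑' j, t j - ∑ j ∈ Finset.range k, t j) atTop (𝓝 0) := by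
    simpa using tendsto_const_nhds (x := ∑' j, t j).sub hts.hasSum.tendsto_sum_nat
  have hvl : Tendsto v atTop (𝓝 l) := by
    simpa [hy] using hlim.sub htail
  have hl0 : 0 ≤ l := ge_of_tendsto' hvl hv
  rcases hl0.eq_or_lt with hl | hl
  · rwa [← hl] at hvl
  exfalso
  have hsum (K : ℕ) : κ * ∑ k ∈ Finset.range K, α k * v k ≤ y 0 - y K := by
    induction K with
    | zero => simp
    | succ K ih => rw [Finset.sum_range_succ, mul_add]; linarith [hstep K]
  have hsumm : Summable fun k => α k * v k := by
    refine summable_of_sum_range_le (c := y 0 / κ) hprod fun K => ?_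
    rw [le_div_iff₀ hκ]
    linarith [hsum K, hy0 K]
  have hαs : Summable α := by
    refine (hsumm.mul_left (2 / l)).of_norm_bounded_eventually_nat ?_
    filter_upwards [hvl.eventually_const_lt (show l / 2 < l by linarith)] with k hk
    rw [Real.norm_of_nonneg (hα k), div_mul_eq_mul_div, le_div_iff₀ hl]
    nlinarith [hα k]
  exact not_tendsto_atTop_of_tendsto_nhds hαs.hasSum.tendsto_sum_nat hdiv

variable {Ω : Type*} {mΩ : MeasurableSpace Ω} {P : Measure Ω} [IsProbabilityMeasure P]

lemma tendsto_zero_of_setIntegral_le_one_sub_mul_add (ℱ : Filtration ℕ mΩ) {Z : ℕ → Ω → ℝ}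
    {α t : ℕ → ℝ} {κ : ℝ} (hκ : 0 < κ) (hadp : StronglyAdapted ℱ Z)
    (hint : ∀ k, Integrable (Z k) P) (hZ : ∀ k ω, 0 ≤ Z k ω) (hα : ∀ k, 0 ≤ α k)
    (ht : ∀ k, 0 ≤ t k) (hts : Summable t)
    (hdiv : Tendsto (fun K : ℕ => ∑ k ∈ Finset.range K, α k) atTop atTop)
    (h : ∀ k S, MeasurableSet[ℱ k] S →
      ∫ ω in S, Z (k + 1) ω ∂P ≤ (1 - κ * α k) * ∫ ω in S, Z k ω ∂P + t k * P.real S) :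
    Tendsto (fun k => ∫ ω, Z k ω ∂P) atTop (𝓝 0) ∧
      ∀ᵐ ω ∂P, Tendsto (fun k => Z k ω) atTop (𝓝 0) := by
  have hE : Tendsto (fun k => ∫ ω, Z k ω ∂P) atTop (𝓝 0) := by
    refine tendsto_zero_of_le_one_sub_mul_add hκ (fun k => integral_nonneg (hZ k)) hα ht hts hdiv
      fun k => ?_
    simpa using h k Set.univ MeasurableSet.univ
  refine ⟨hE, ?_⟩
  set T : ℕ → ℝ := fun k => ∑' j, t j - ∑ j ∈ Finset.range k, t j with hT
  have hT0 (k) : 0 ≤ T k := sum_range_le_tsum_sub ht hts k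
  have htail : Tendsto T atTop (𝓝 0) := by
    simpa using tendsto_const_nhds (x := ∑' j, t j).sub hts.hasSum.tendsto_sum_nat
  set Y : ℕ → Ω → ℝ := fun k ω => Z k ω + T k with hY
  have hYint (k) : Integrable (Y k) P := (hint k).add (integrable_const _)
  have hsup : Supermartingale Y ℱ P := by
    refine supermartingale_of_setIntegral_succ_le
      (fun k => (hadp k).add stronglyMeasurable_const) hYint fun k S hS => ?_
    simp only [hY]
    rw [integral_add (hint _).integrableOn (integrable_const _),
      integral_add (hint _).integrableOn (integrable_const _), setIntegral_const,
      setIntegral_const, smul_eq_mul, smul_eq_mul]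
    have hTs : T (k + 1) = T k - t k := by simp only [hT, Finset.sum_range_succ]; ring
    have h0 : 0 ≤ κ * α k * ∫ ω in S, Z k ω ∂P :=
      mul_nonneg (mul_nonneg hκ.le (hα k)) (integral_nonneg (hZ k))
    rw [hTs]
    linarith [h k S hS]
  have hbdd (k) : eLpNorm ((-Y) k) 1 P ≤ (Real.toNNReal (∫ ω, Y 0 ω ∂P) : ENNReal) := by
    rw [Pi.neg_apply, eLpNorm_neg, eLpNorm_one_eq_lintegral_enorm,
      ← ofReal_integral_norm_eq_lintegral_enorm (hYint k)]
    refine ENNReal.ofReal_le_ofReal ?_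
    have e (ω) : ‖Y k ω‖ = Y k ω := Real.norm_of_nonneg (add_nonneg (hZ k ω) (hT0 k))
    simp_rw [e]
    simpa using hsup.setIntegral_le (Nat.zero_le k) MeasurableSet.univ
  have hconv := hsup.neg.exists_ae_tendsto_of_bdd hbdd
  have hmeas : TendstoInMeasure P Z atTop (fun _ => (0 : ℝ)) := by
    refine tendstoInMeasure_of_tendsto_eLpNorm one_ne_zero
      (fun k => (hint k).aestronglyMeasurable) aestronglyMeasurable_const ?_
    have e (k) : eLpNorm (Z k - fun _ => (0 : ℝ)) 1 P = ENNReal.ofReal (∫ ω, Z k ω ∂P) := by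
      have : (Z k - fun _ => (0 : ℝ)) = Z k := by ext; simp
      rw [this, eLpNorm_one_eq_lintegral_enorm,
        ← ofReal_integral_norm_eq_lintegral_enorm (hint k)]
      simp_rw [Real.norm_of_nonneg (hZ k _)]
    simp_rw [e]
    simpa using ENNReal.tendsto_ofReal hE
  obtain ⟨ns, hns, hsub⟩ := hmeas.exists_seq_tendsto_ae
  filter_upwards [hconv, hsub] with ω ⟨c, hc⟩ hω
  have hZc : Tendsto (fun k => Z k ω) atTop (𝓝 (-c)) := by
    have := hc.neg.sub htail
    simpa [hY] using this
  have := tendsto_nhds_unique (hZc.comp hns.tendsto_atTop) hω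
  rwa [this] at hZc

/-- An almost-supermartingale with a multiplicative drift of divergent sum and summable
perturbations tends to zero in mean and almost surely. -/
theorem tendsto_zero_of_setIntegral_le (ℱ : Filtration ℕ mΩ) {V : ℕ → Ω → ℝ}
    {α s t : ℕ → ℝ} {κ : ℝ} (hκ : 0 < κ) (hadp : StronglyAdapted ℱ V)
    (hint : ∀ k, Integrable (V k) P) (hV : ∀ k ω, 0 ≤ V k ω) (hα : ∀ k, 0 ≤ α k)
    (hs : ∀ k, 0 ≤ s k) (hss : Summable s) (ht : ∀ k, 0 ≤ t k) (hts : Summable t)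
    (hdiv : Tendsto (fun K : ℕ => ∑ k ∈ Finset.range K, α k) atTop atTop)
    (h : ∀ k S, MeasurableSet[ℱ k] S →
      ∫ ω in S, V (k + 1) ω ∂P ≤ (1 - κ * α k + s k) * ∫ ω in S, V k ω ∂P + t k * P.real S) :
    Tendsto (fun k => ∫ ω, V k ω ∂P) atTop (𝓝 0) ∧
      ∀ᵐ ω ∂P, Tendsto (fun k => V k ω) atTop (𝓝 0) := by
  set p : ℕ → ℝ := fun k => ∏ j ∈ Finset.range k, (1 + s j) with hp
  set B : ℝ := Real.exp (∑' j, s j) with hB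
  have hp1 (k) : 1 ≤ p k := by
    simpa using Finset.prod_le_prod (s := Finset.range k) (f := fun _ => (1 : ℝ))
      (fun _ _ => zero_le_one) fun j _ => show (1 : ℝ) ≤ 1 + s j by linarith [hs j]
  have hpB (k) : p k ≤ B := by
    calc p k ≤ ∏ j ∈ Finset.range k, Real.exp (s j) :=
          Finset.prod_le_prod (fun j _ => by linarith [hs j])
            fun j _ => by linarith [Real.add_one_le_exp (s j)]
      _ = Real.exp (∑ j ∈ Finset.range k, s j) := (Real.exp_sum _ _).symm
      _ ≤ B := Real.exp_le_exp.2 (hss.sum_le_tsum _ fun j _ => hs j)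
  have hp0 (k) : 0 < p k := zero_lt_one.trans_le (hp1 k)
  have hB0 : 0 < B := Real.exp_pos _
  have hsB (k) : 1 + s k ≤ B := by
    have := hss.le_tsum k fun j _ => hs j
    linarith [Real.add_one_le_exp (∑' j, s j)]
  have key := tendsto_zero_of_setIntegral_le_one_sub_mul_add (P := P) ℱ
    (Z := fun k ω => (p k)⁻¹ * V k ω) (div_pos hκ hB0) (fun k => (hadp k).const_mul _)
    (fun k => (hint k).const_mul _) (fun k ω => mul_nonneg (inv_nonneg.2 (hp0 k).le) (hV k ω))
    hα ht hts hdiv fun k S hS => by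
      simp only [integral_const_mul]
      have hI : 0 ≤ ∫ ω in S, V k ω ∂P := integral_nonneg (hV k)
      set I := ∫ ω in S, V k ω ∂P
      have hps : p (k + 1) = p k * (1 + s k) := Finset.prod_range_succ _ _
      have h1 : (p (k + 1))⁻¹ * ∫ ω in S, V (k + 1) ω ∂P
          ≤ (p (k + 1))⁻¹ * ((1 - κ * α k + s k) * I + t k * P.real S) :=
        mul_le_mul_of_nonneg_left (h k S hS) (inv_nonneg.2 (hp0 _).le)
      refine h1.trans ?_
      rw [mul_add]
      refine add_le_add ?_ ?_
      · have hs1 : 0 < 1 + s k := by linarith [hs k]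
        have e : (p (k + 1))⁻¹ * ((1 - κ * α k + s k) * I)
            = (1 - κ / (1 + s k) * α k) * ((p k)⁻¹ * I) := by
          have := (hp0 k).ne'
          rw [hps]; field_simp; ring
        rw [e]
        refine mul_le_mul_of_nonneg_right ?_ (mul_nonneg (inv_nonneg.2 (hp0 k).le) hI)
        have := mul_le_mul_of_nonneg_right
          (div_le_div_of_nonneg_left hκ.le hs1 (hsB k)) (hα k)
        linarith
      · exact mul_le_of_le_one_left (mul_nonneg (ht k) measureReal_nonneg)
          (inv_le_one_of_one_le₀ (hp1 _))
  constructor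
  · refine squeeze_zero (fun k => integral_nonneg (hV k)) (fun k => ?_)
      (by simpa using key.1.const_mul B)
    rw [integral_const_mul, ← mul_assoc, ← div_eq_mul_inv]
    exact le_mul_of_one_le_left (integral_nonneg (hV k)) ((one_le_div (hp0 k)).2 (hpB k))
  · filter_upwards [key.2] with ω hω
    refine squeeze_zero (fun k => hV k ω) (fun k => ?_) (by simpa using hω.const_mul B)
    rw [← mul_assoc, ← div_eq_mul_inv]
    exact le_mul_of_one_le_left (hV k ω) ((one_le_div (hp0 k)).2 (hpB k))

end AlmostSupermartingale

section Laplace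

variable {b : ℝ}

lemma laplace_density_nonneg (hb : 0 < b) (t : ℝ) : 0 ≤ Real.exp (-|t| / b) / (2 * b) := by
  positivity

lemma integral_sq_mul_laplace_density (hb : 0 < b) :
    ∫ t : ℝ, Real.exp (-|t| / b) / (2 * b) * t ^ 2 = 2 * b ^ 2 := by
  have h := integral_comp_abs (f := fun t : ℝ => Real.exp (-t / b) / (2 * b) * t ^ 2)
  simp only [sq_abs] at h
  rw [h]
  have h3 := Real.integral_rpow_mul_exp_neg_mul_Ioi (a := 3) (r := b⁻¹) (by norm_num)
    (inv_pos.2 hb)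
  have hG : Real.Gamma 3 = 2 := by
    rw [show (3 : ℝ) = ((2 : ℕ) : ℝ) + 1 by norm_num, Real.Gamma_nat_eq_factorial]
    norm_num
  have e : ∫ t in Set.Ioi (0 : ℝ), Real.exp (-t / b) / (2 * b) * t ^ 2
      = (2 * b)⁻¹ * ∫ t in Set.Ioi (0 : ℝ), t ^ ((3 : ℝ) - 1) * Real.exp (-(b⁻¹ * t)) := by
    rw [← integral_const_mul]
    refine setIntegral_congr_fun measurableSet_Ioi fun t _ => ?_
    have : t ^ ((3 : ℝ) - 1) = t ^ 2 := by
      rw [← Real.rpow_natCast]; norm_num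
    simp only [this]
    rw [show -t / b = -(b⁻¹ * t) by ring]
    ring
  rw [e, h3, hG]
  have h33 : (1 / b⁻¹) ^ (3 : ℝ) = b ^ 3 := by
    rw [← Real.rpow_natCast]; norm_num
  rw [h33]
  field_simp

lemma laplaceLaw_integral_sq (hb : 0 < b) :
    Integrable (fun t : ℝ => t ^ 2) (laplaceLaw b) ∧ ∫ t, t ^ 2 ∂(laplaceLaw b) = 2 * b ^ 2 := by
  have hm : Measurable fun t : ℝ => ENNReal.ofReal (Real.exp (-|t| / b) / (2 * b)) := by
    fun_prop
  have hval : ∫ t, t ^ 2 ∂(laplaceLaw b) = 2 * b ^ 2 := by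
    rw [laplaceLaw, integral_withDensity_eq_integral_toReal_smul hm (ae_of_all _ fun _ =>
      ENNReal.ofReal_lt_top), ← integral_sq_mul_laplace_density hb]
    simp_rw [ENNReal.toReal_ofReal (laplace_density_nonneg hb _), smul_eq_mul]
  refine ⟨?_, hval⟩
  by_contra hni
  rw [integral_undef hni] at hval
  have : 0 < 2 * b ^ 2 := by positivity
  exact this.ne hval

lemma laplaceLaw_integral_id (hb : 0 < b) : ∫ t, t ∂(laplaceLaw b) = 0 := by
  have hm : Measurable fun t : ℝ => ENNReal.ofReal (Real.exp (-|t| / b) / (2 * b)) := by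
    fun_prop
  rw [laplaceLaw, integral_withDensity_eq_integral_toReal_smul hm (ae_of_all _ fun _ =>
      ENNReal.ofReal_lt_top)]
  simp_rw [ENNReal.toReal_ofReal (laplace_density_nonneg hb _), smul_eq_mul]
  have h := integral_neg_eq_self (fun t : ℝ => Real.exp (-|t| / b) / (2 * b) * t) volume
  simp only [abs_neg, mul_neg, integral_neg] at h
  linarith

variable {Ω : Type*} {mΩ : MeasurableSpace Ω} {P : Measure Ω} {d : ℕ}

lemma memLp_of_laplace (hb : 0 < b) {W : Ω → E d} (hW : Measurable W)
    (hlaw : ∀ c, P.map (fun ω => W ω c) = laplaceLaw b) :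
    MemLp W 2 P ∧ ∫ ω, ‖W ω‖ ^ 2 ∂P = 2 * d * b ^ 2 := by
  have hc (c : Fin d) : Measurable fun ω => W ω c := by fun_prop
  have hsq (c : Fin d) : Integrable (fun ω => W ω c ^ 2) P := by
    have := (laplaceLaw_integral_sq hb).1
    rw [← hlaw c] at this
    exact this.comp_measurable (hc c)
  have hval (c : Fin d) : ∫ ω, W ω c ^ 2 ∂P = 2 * b ^ 2 := by
    rw [← (laplaceLaw_integral_sq hb).2, ← hlaw c,
      integral_map (hc c).aemeasurable (by fun_prop)]
  have e (ω) : ‖W ω‖ ^ 2 = ∑ c, W ω c ^ 2 := by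
    simp [EuclideanSpace.norm_sq_eq]
  constructor
  · rw [memLp_two_iff_integrable_sq_norm hW.aestronglyMeasurable]
    simp_rw [e]
    exact integrable_finsetSum _ fun c _ => hsq c
  · simp_rw [e]
    rw [integral_finsetSum _ fun c _ => hsq c]
    simp_rw [hval]
    simp; ring

lemma integral_eq_zero_of_laplace [IsFiniteMeasure P] (hb : 0 < b) {W : Ω → E d}
    (hW : Measurable W) (hlaw : ∀ c, P.map (fun ω => W ω c) = laplaceLaw b) :
    ∫ ω, W ω ∂P = 0 := by
  have hint : Integrable W P := (memLp_of_laplace hb hW hlaw).1.integrable one_le_two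
  ext c
  have h := (EuclideanSpace.proj (𝕜 := ℝ) c).integral_comp_comm hint
  rw [PiLp.zero_apply]
  refine h.symm.trans ?_
  change ∫ ω, W ω c ∂P = 0
  rw [ ← laplaceLaw_integral_id hb, ← hlaw c,
    integral_map (by fun_prop) (by fun_prop)]

end Laplace

section StronglyMonotone

variable {d : ℕ}

lemma exists_zero_of_lipschitz_stronglyMonotone {h : E d → E d} {M μ : ℝ} (hM : 0 < M)
    (hμ : 0 < μ) (hL : ∀ x y, ‖h x - h y‖ ≤ M * ‖x - y‖)
    (hmono : ∀ x y, μ * ‖x - y‖ ^ 2 ≤ ⟪h x - h y, x - y⟫) : ∃ x, h x = 0 := by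
  set τ : ℝ := μ / M ^ 2 with hτ
  have hτ0 : 0 < τ := by positivity
  set q : ℝ := 1 - μ ^ 2 / M ^ 2 with hq
  have hq1 : q < 1 := by
    have : 0 < μ ^ 2 / M ^ 2 := by positivity
    linarith
  have hsq (x y : E d) : ‖(x - τ • h x) - (y - τ • h y)‖ ^ 2 ≤ q * ‖x - y‖ ^ 2 := by
    have e : (x - τ • h x) - (y - τ • h y) = (x - y) - τ • (h x - h y) := by module
    rw [e, norm_sub_sq_real, inner_smul_right, norm_smul, Real.norm_of_nonneg hτ0.le,
      real_inner_comm]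
    have h1 := hmono x y
    have h2 : ‖h x - h y‖ ^ 2 ≤ M ^ 2 * ‖x - y‖ ^ 2 := by
      rw [← mul_pow]; exact pow_le_pow_left₀ (norm_nonneg _) (hL x y) 2
    have h3 : (τ * ‖h x - h y‖) ^ 2 ≤ τ * μ * ‖x - y‖ ^ 2 := by
      calc (τ * ‖h x - h y‖) ^ 2 = τ ^ 2 * ‖h x - h y‖ ^ 2 := by ring
        _ ≤ τ ^ 2 * (M ^ 2 * ‖x - y‖ ^ 2) := by gcongr
        _ = τ * μ * ‖x - y‖ ^ 2 := by rw [hτ]; field_simp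
    have h4 : q = 1 - τ * μ := by rw [hq, hτ]; ring
    rw [h4]
    nlinarith [mul_le_mul_of_nonneg_left h1 hτ0.le]
  have hK : LipschitzWith (Real.toNNReal (√(max q 0))) fun x => x - τ • h x := by
    refine LipschitzWith.of_dist_le_mul fun x y => ?_
    rw [dist_eq_norm, dist_eq_norm, Real.coe_toNNReal _ (Real.sqrt_nonneg _)]
    refine abs_le_of_sq_le_sq' ?_ (by positivity) |>.2
    rw [mul_pow, Real.sq_sqrt (le_max_right _ _)]
    exact (hsq x y).trans (mul_le_mul_of_nonneg_right (le_max_left _ _) (sq_nonneg _))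
  have hc : ContractingWith (Real.toNNReal (√(max q 0))) fun x => x - τ • h x :=
    ⟨by
      rw [Real.toNNReal_lt_one, Real.sqrt_lt' one_pos]
      simp [hq1], hK⟩
  refine ⟨hc.fixedPoint, ?_⟩
  have := hc.fixedPoint_isFixedPt
  simp only [Function.IsFixedPt, sub_eq_self, smul_eq_zero] at this
  exact this.resolve_left hτ0.ne'

lemma le_of_gradient_monotone_of_eq_zero {f : E d → ℝ} {f' : E d → E d}
    (hf : ∀ x, HasGradientAt f (f' x) x) (hmono : ∀ x y, 0 ≤ ⟪f' x - f' y, x - y⟫) {x : E d}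
    (hx : f' x = 0) (y : E d) : f x ≤ f y := by
  have hd (t : ℝ) : HasDerivAt (fun t : ℝ => f (x + t • (y - x))) ⟪f' (x + t • (y - x)), y - x⟫ t := by
    have h1 : HasDerivAt (fun t : ℝ => x + t • (y - x)) (y - x) t := by
      simpa using ((hasDerivAt_id t).smul_const (y - x)).const_add x
    have h2 := (hf (x + t • (y - x))).hasFDerivAt.comp_hasDerivAt t h1
    rw [InnerProductSpace.toDual_apply_apply] at h2
    exact h2
  have hm := monotoneOn_of_deriv_nonneg (convex_Ici (0 : ℝ)) (f := fun t : ℝ => f (x + t • (y - x)))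
    (fun t _ => (hd t).continuousAt.continuousWithinAt)
    (fun t _ => (hd t).differentiableAt.differentiableWithinAt) (fun t ht => by
      rw [(hd t).deriv]
      have ht0 : 0 < t := by simpa using ht
      have := hmono (x + t • (y - x)) x
      rw [hx, sub_zero, add_sub_cancel_left, inner_smul_right] at this
      exact nonneg_of_mul_nonneg_right this ht0)
  simpa using hm (Set.mem_Ici.2 le_rfl) (Set.mem_Ici.2 zero_le_one) zero_le_one

end StronglyMonotone

section Lyapunov

variable {n d : ℕ}

/-- The average of the agents' states. -/
noncomputable def mean (x : Fin n → E d) : E d := (n : ℝ)⁻¹ • ∑ i, x i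

/-- The deviation of the agents' states from their average. -/
noncomputable def dev (x : Fin n → E d) (i : Fin n) : E d := x i - mean x

/-- The Lyapunov function: optimality error of the average plus weighted consensus error. -/
noncomputable def lyapunov (a : ℝ) (xs : E d) (x : Fin n → E d) : ℝ :=
  ‖mean x - xs‖ ^ 2 + a * ∑ i, ‖dev x i‖ ^ 2

/-- One noiseless step of the algorithm with gradient field `F`. -/
noncomputable def drift (A : Matrix (Fin n) (Fin n) ℝ) (F : Fin n → E d → E d) (α β : ℝ)
    (x : Fin n → E d) (i : Fin n) : E d :=
  (1 - β) • x i + β • ∑ j, A i j • x j - α • F i (x i)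

lemma mean_sub_smul (x w : Fin n → E d) (α : ℝ) :
    mean (fun i => x i - α • w i) = mean x - α • mean w := by
  simp only [mean, Finset.sum_sub_distrib, ← Finset.smul_sum]
  module

lemma dev_sub_smul (x w : Fin n → E d) (α : ℝ) (i : Fin n) :
    dev (fun i => x i - α • w i) i = dev x i - α • dev w i := by
  simp only [dev, mean_sub_smul]
  module

lemma sum_eq_smul_mean (hn : n ≠ 0) (x : Fin n → E d) : ∑ i, x i = (n : ℝ) • mean x := by
  have : (n : ℝ) ≠ 0 := by exact_mod_cast hn
  rw [mean, smul_smul, mul_inv_cancel₀ this, one_smul]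

lemma sum_dev (hn : n ≠ 0) (x : Fin n → E d) : ∑ i, dev x i = 0 := by
  simp only [dev, Finset.sum_sub_distrib, sum_eq_smul_mean hn x, Finset.sum_const,
    Finset.card_univ, Fintype.card_fin, Nat.cast_smul_eq_nsmul, sub_self]

lemma sum_norm_sub_sq (hn : n ≠ 0) (x : Fin n → E d) (z : E d) :
    ∑ i, ‖x i - z‖ ^ 2 = n * ‖mean x - z‖ ^ 2 + ∑ i, ‖dev x i‖ ^ 2 := by
  have e (i) : ‖x i - z‖ ^ 2
      = ‖dev x i‖ ^ 2 + 2 * ⟪dev x i, mean x - z⟫ + ‖mean x - z‖ ^ 2 := by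
    rw [← norm_add_sq_real, dev]
    congr 2
    module
  simp_rw [e, Finset.sum_add_distrib, ← Finset.mul_sum, ← sum_inner, sum_dev hn, inner_zero_left]
  simp; ring

lemma lyapunov_nonneg {a : ℝ} (ha : 0 ≤ a) (xs : E d) (x : Fin n → E d) :
    0 ≤ lyapunov a xs x := by
  unfold lyapunov; positivity

lemma one_le_cast (hn : n ≠ 0) : (1 : ℝ) ≤ n := by
  exact_mod_cast Nat.one_le_iff_ne_zero.2 hn

lemma lyapunov_zero_le (hn : n ≠ 0) {a : ℝ} (ha : 1 ≤ a) (w : Fin n → E d) :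
    lyapunov a 0 w ≤ a * ∑ i, ‖w i‖ ^ 2 := by
  have h := sum_norm_sub_sq hn w 0
  simp only [sub_zero] at h
  rw [lyapunov, h, sub_zero, mul_add]
  have h1 : 1 * ‖mean w‖ ^ 2 ≤ a * n * ‖mean w‖ ^ 2 :=
    mul_le_mul_of_nonneg_right (one_le_mul_of_one_le_of_one_le ha (one_le_cast hn)) (sq_nonneg _)
  linarith

lemma norm_sub_sq_le_lyapunov {a : ℝ} (ha : 1 ≤ a) (xs : E d) (x : Fin n → E d) (i : Fin n) :
    ‖x i - xs‖ ^ 2 ≤ 2 * lyapunov a xs x := by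
  have h1 : ‖x i - xs‖ ^ 2 ≤ 2 * (‖mean x - xs‖ ^ 2 + ‖dev x i‖ ^ 2) := by
    have e : x i - xs = (mean x - xs) + dev x i := by rw [dev]; module
    have h := parallelogram_law_with_norm ℝ (mean x - xs) (dev x i)
    rw [e]
    nlinarith [sq_nonneg ‖mean x - xs - dev x i‖]
  have h2 : ‖dev x i‖ ^ 2 ≤ ∑ j, ‖dev x j‖ ^ 2 :=
    Finset.single_le_sum (f := fun j => ‖dev x j‖ ^ 2) (fun j _ => sq_nonneg _)
      (Finset.mem_univ i)
  have h3 : ∑ j, ‖dev x j‖ ^ 2 ≤ a * ∑ j, ‖dev x j‖ ^ 2 :=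
    le_mul_of_one_le_left (by positivity) ha
  rw [lyapunov]
  linarith

lemma sum_norm_sub_sq_le_lyapunov (hn : n ≠ 0) {a : ℝ} (ha : 1 ≤ a) (xs : E d)
    (x : Fin n → E d) : ∑ i, ‖x i - xs‖ ^ 2 ≤ (n + 1) * lyapunov a xs x := by
  rw [sum_norm_sub_sq hn, lyapunov]
  have hD : 0 ≤ ∑ i, ‖dev x i‖ ^ 2 := by positivity
  have h1 : ∑ i, ‖dev x i‖ ^ 2 ≤ a * ∑ i, ‖dev x i‖ ^ 2 := le_mul_of_one_le_left hD ha
  have h2 : (0 : ℝ) ≤ n * (a * ∑ i, ‖dev x i‖ ^ 2) := by positivity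
  nlinarith [sq_nonneg ‖mean x - xs‖]

/-- Half the gradient of the Lyapunov function with respect to agent `i`'s state. -/
noncomputable def lyapunovGrad (a : ℝ) (xs : E d) (x : Fin n → E d) (i : Fin n) : E d :=
  (n : ℝ)⁻¹ • (mean x - xs) + a • dev x i

lemma lyapunov_sub_smul (hn : n ≠ 0) (a : ℝ) (xs : E d) (x w : Fin n → E d) (α : ℝ) :
    lyapunov a xs (fun i => x i - α • w i)
      = lyapunov a xs x - 2 * α * ∑ i, ⟪lyapunovGrad a xs x i, w i⟫
        + α ^ 2 * lyapunov a 0 w := by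
  have h1 : ‖mean x - α • mean w - xs‖ ^ 2
      = ‖mean x - xs‖ ^ 2 - 2 * α * ⟪mean x - xs, mean w⟫ + α ^ 2 * ‖mean w‖ ^ 2 := by
    rw [sub_right_comm, norm_sub_sq_real, inner_smul_right, norm_smul, mul_pow, Real.norm_eq_abs,
      sq_abs]
    ring
  have h2 (i) : ‖dev x i - α • dev w i‖ ^ 2
      = ‖dev x i‖ ^ 2 - 2 * α * ⟪dev x i, dev w i⟫ + α ^ 2 * ‖dev w i‖ ^ 2 := by
    rw [norm_sub_sq_real, inner_smul_right, norm_smul, mul_pow, Real.norm_eq_abs, sq_abs]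
    ring
  have h3 : ∑ i, ⟪dev x i, dev w i⟫ = ∑ i, ⟪dev x i, w i⟫ := by
    have e (i) : ⟪dev x i, dev w i⟫ = ⟪dev x i, w i⟫ - ⟪dev x i, mean w⟫ := by
      rw [← inner_sub_right]; rfl
    simp_rw [e, Finset.sum_sub_distrib, ← sum_inner, sum_dev hn, inner_zero_left, sub_zero]
  have h4 : ∑ i, ⟪lyapunovGrad a xs x i, w i⟫
      = ⟪mean x - xs, mean w⟫ + a * ∑ i, ⟪dev x i, w i⟫ := by
    simp only [lyapunovGrad, inner_add_left, inner_smul_left, conj_trivial,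
      Finset.sum_add_distrib, ← Finset.mul_sum]
    rw [← inner_sum, mean.eq_1 w, inner_smul_right]
  rw [h4, ← h3]
  simp only [lyapunov, mean_sub_smul, dev_sub_smul, h1, h2, Finset.sum_add_distrib,
    Finset.sum_sub_distrib, ← Finset.mul_sum, sub_zero]
  ring

lemma norm_convex_comb_sq_le {β : ℝ} (h0 : 0 ≤ β) (h1 : β ≤ 1) (u v : E d) :
    ‖(1 - β) • u + β • v‖ ^ 2 ≤ (1 - β) * ‖u‖ ^ 2 + β * ‖v‖ ^ 2 := by
  rw [norm_add_sq_real, inner_smul_left, inner_smul_right, norm_smul, norm_smul,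
    Real.norm_of_nonneg h0, Real.norm_of_nonneg (by linarith : 0 ≤ 1 - β)]
  have h := real_inner_le_norm u v
  have h' : 0 ≤ (1 - β) * β := mul_nonneg (by linarith) h0
  have h2 : (1 - β) * β * (2 * ⟪u, v⟫) ≤ (1 - β) * β * (‖u‖ ^ 2 + ‖v‖ ^ 2) :=
    mul_le_mul_of_nonneg_left (by nlinarith [sq_nonneg (‖u‖ - ‖v‖)]) h'
  simp only [conj_trivial]
  nlinarith

lemma norm_sub_sq_le_young {τ : ℝ} (hτ : 0 < τ) (u v : E d) :
    ‖u - v‖ ^ 2 ≤ (1 + τ) * ‖u‖ ^ 2 + (1 + τ⁻¹) * ‖v‖ ^ 2 := by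
  rw [norm_sub_sq_real]
  have h := abs_le.1 (abs_real_inner_le_norm u v)
  have h2 : 2 * (‖u‖ * ‖v‖) ≤ τ * ‖u‖ ^ 2 + τ⁻¹ * ‖v‖ ^ 2 := by
    have e : τ * ‖u‖ ^ 2 + τ⁻¹ * ‖v‖ ^ 2 - 2 * (‖u‖ * ‖v‖) = τ * (‖u‖ - τ⁻¹ * ‖v‖) ^ 2 := by
      field_simp; ring
    have : 0 ≤ τ * (‖u‖ - τ⁻¹ * ‖v‖) ^ 2 := by positivity
    linarith
  linarith [h.1]

variable {A : Matrix (Fin n) (Fin n) ℝ} {F : Fin n → E d → E d} {α β : ℝ}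

lemma mean_mix (hA : A ∈ doublyStochastic ℝ (Fin n)) (β : ℝ) (x : Fin n → E d) :
    mean (fun i => (1 - β) • x i + β • ∑ j, A i j • x j) = mean x := by
  have h : ∑ i, ∑ j, A i j • x j = ∑ j, x j := by
    rw [Finset.sum_comm]
    simp_rw [← Finset.sum_smul, sum_col_of_mem_doublyStochastic hA, one_smul]
  simp only [mean, Finset.sum_add_distrib, ← Finset.smul_sum, h]
  module

lemma dev_mix (hA : A ∈ doublyStochastic ℝ (Fin n)) (β : ℝ) (x : Fin n → E d)
    (i : Fin n) : dev (fun i => (1 - β) • x i + β • ∑ j, A i j • x j) i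
      = (1 - β) • dev x i + β • ∑ j, A i j • dev x j := by
  rw [dev, mean_mix hA]
  simp only [dev, smul_sub, Finset.sum_sub_distrib, ← Finset.sum_smul,
    sum_row_of_mem_doublyStochastic hA]
  module

lemma mean_drift (hA : A ∈ doublyStochastic ℝ (Fin n)) (x : Fin n → E d) :
    mean (drift A F α β x) = mean x - α • mean fun i => F i (x i) := by
  rw [← mean_mix hA β x, ← mean_sub_smul]
  rfl

lemma dev_drift (hA : A ∈ doublyStochastic ℝ (Fin n)) (x : Fin n → E d)
    (i : Fin n) : dev (drift A F α β x) i
      = ((1 - β) • dev x i + β • ∑ j, A i j • dev x j) - α • dev (fun i => F i (x i)) i := by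
  rw [← dev_mix hA β x, ← dev_sub_smul]
  rfl

lemma sum_norm_dev_drift_sq_le (hn : n ≠ 0) (hA : A ∈ doublyStochastic ℝ (Fin n))
    (hσ : secondSingularValue A < 1) (hβ0 : 0 < β) (hβ1 : β < 1) (x : Fin n → E d) :
    ∑ i, ‖dev (drift A F α β x) i‖ ^ 2
      ≤ (1 - (1 - secondSingularValue A) * β / 2) * ∑ i, ‖dev x i‖ ^ 2
        + 3 / (1 - secondSingularValue A) * (α ^ 2 / β) * ∑ i, ‖F i (x i)‖ ^ 2 := by
  have hσ0 : 0 ≤ secondSingularValue A := LinearMap.singularValues_nonneg _ 1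
  set s := secondSingularValue A
  set D := ∑ i, ‖dev x i‖ ^ 2
  have hD : 0 ≤ D := by positivity
  have hc : 0 < 1 - s := by linarith
  set τ : ℝ := (1 - s) * β / 2 with hτ
  have hτ0 : 0 < τ := by positivity
  have hτ1 : τ ≤ 1 / 2 := by nlinarith
  have hmix : ∑ i, ‖(1 - β) • dev x i + β • ∑ j, A i j • dev x j‖ ^ 2 ≤ (1 - 2 * τ) * D := by
    calc _ ≤ ∑ i, ((1 - β) * ‖dev x i‖ ^ 2 + β * ‖∑ j, A i j • dev x j‖ ^ 2) :=
          Finset.sum_le_sum fun i _ => norm_convex_comb_sq_le hβ0.le hβ1.le _ _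
      _ = (1 - β) * D + β * ∑ i, ‖∑ j, A i j • dev x j‖ ^ 2 := by
          rw [Finset.sum_add_distrib, ← Finset.mul_sum, ← Finset.mul_sum]
      _ ≤ (1 - β) * D + β * (s ^ 2 * D) := by
          gcongr
          exact sum_norm_mix_sq_le hA hσ _ (sum_dev hn x)
      _ ≤ (1 - β) * D + β * (s * D) := by
          gcongr
          nlinarith
      _ = (1 - 2 * τ) * D := by rw [hτ]; ring
  have hdevF : ∑ i, ‖dev (fun i => F i (x i)) i‖ ^ 2 ≤ ∑ i, ‖F i (x i)‖ ^ 2 := by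
    have h := sum_norm_sub_sq hn (fun i => F i (x i)) 0
    simp only [sub_zero] at h
    rw [h]
    have : (0 : ℝ) ≤ n * ‖mean fun i => F i (x i)‖ ^ 2 := by positivity
    linarith
  set H := ∑ i, ‖F i (x i)‖ ^ 2
  have hH : 0 ≤ H := by positivity
  calc _ ≤ ∑ i, ((1 + τ) * ‖(1 - β) • dev x i + β • ∑ j, A i j • dev x j‖ ^ 2
            + (1 + τ⁻¹) * (α ^ 2 * ‖dev (fun i => F i (x i)) i‖ ^ 2)) := by
        refine Finset.sum_le_sum fun i _ => ?_
        rw [dev_drift hA]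
        refine (norm_sub_sq_le_young hτ0 _ _).trans_eq ?_
        rw [norm_smul, mul_pow, Real.norm_eq_abs, sq_abs]
    _ = (1 + τ) * ∑ i, ‖(1 - β) • dev x i + β • ∑ j, A i j • dev x j‖ ^ 2
          + (1 + τ⁻¹) * (α ^ 2 * ∑ i, ‖dev (fun i => F i (x i)) i‖ ^ 2) := by
        simp only [Finset.sum_add_distrib, ← Finset.mul_sum]
    _ ≤ (1 + τ) * ((1 - 2 * τ) * D) + (1 + τ⁻¹) * (α ^ 2 * H) := by gcongr
    _ ≤ (1 - τ) * D + 3 / (2 * τ) * (α ^ 2 * H) := by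
        gcongr ?_ + ?_ * _
        · nlinarith [mul_nonneg (sq_nonneg τ) hD]
        · rw [le_div_iff₀ (by positivity), add_mul]
          have : τ⁻¹ * (2 * τ) = 2 := by field_simp
          linarith
    _ = (1 - τ) * D + 3 / (1 - s) * (α ^ 2 / β) * H := by
        congr 1
        rw [hτ]
        field_simp

lemma le_inner_mean {L : Fin n → ℝ} {μ : ℝ} (hn : n ≠ 0) (hμ : 0 < μ)
    (hL : ∀ i x y, ‖F i x - F i y‖ ≤ L i * ‖x - y‖)
    (hmono : ∀ i x y, μ * ‖x - y‖ ^ 2 ≤ ⟪F i x - F i y, x - y⟫)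
    {xs : E d} (hxs : ∑ i, F i xs = 0) (x : Fin n → E d) :
    μ / 2 * ‖mean x - xs‖ ^ 2 - (∑ i, L i ^ 2) / (2 * μ) * ∑ i, ‖dev x i‖ ^ 2
      ≤ ⟪mean x - xs, mean fun i => F i (x i)⟫ := by
  set p := mean x
  set u := ‖p - xs‖ with hu
  have hn1 := one_le_cast hn
  have hterm (i) : μ / 2 * u ^ 2 - (∑ i, L i ^ 2) / (2 * μ) * ‖dev x i‖ ^ 2
      ≤ ⟪p - xs, F i (x i) - F i xs⟫ := by
    have e : ⟪p - xs, F i (x i) - F i xs⟫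
        = ⟪F i p - F i xs, p - xs⟫ + ⟪p - xs, F i (x i) - F i p⟫ := by
      rw [real_inner_comm (p - xs), ← inner_add_right]
      congr 1
      module
    have h1 := hmono i p xs
    have h2 := (abs_le.1 (abs_real_inner_le_norm (p - xs) (F i (x i) - F i p))).1
    have h3 : u * ‖F i (x i) - F i p‖ ≤ u * (L i * ‖dev x i‖) :=
      mul_le_mul_of_nonneg_left (hL i _ _) (norm_nonneg _)
    have h4 : u * (L i * ‖dev x i‖) ≤ μ / 2 * u ^ 2 + L i ^ 2 / (2 * μ) * ‖dev x i‖ ^ 2 := by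
      have e : μ / 2 * u ^ 2 + L i ^ 2 / (2 * μ) * ‖dev x i‖ ^ 2 - u * (L i * ‖dev x i‖)
          = (μ * u - L i * ‖dev x i‖) ^ 2 / (2 * μ) := by field_simp; ring
      have : 0 ≤ (μ * u - L i * ‖dev x i‖) ^ 2 / (2 * μ) := by positivity
      linarith
    have h5 : L i ^ 2 / (2 * μ) * ‖dev x i‖ ^ 2
        ≤ (∑ i, L i ^ 2) / (2 * μ) * ‖dev x i‖ ^ 2 := by
      gcongr
      exact Finset.single_le_sum (f := fun i => L i ^ 2) (fun _ _ => sq_nonneg _)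
        (Finset.mem_univ i)
    rw [e]
    linarith
  have hsum := Finset.sum_le_sum fun i (_ : i ∈ Finset.univ) => hterm i
  rw [← inner_sum, Finset.sum_sub_distrib, Finset.sum_sub_distrib, hxs, sub_zero,
    ← Finset.mul_sum, Finset.sum_const, Finset.card_univ, Fintype.card_fin, nsmul_eq_mul,
    sum_eq_smul_mean hn, inner_smul_right, ← Finset.mul_sum] at hsum
  have hK : 0 ≤ (∑ i, L i ^ 2) / (2 * μ) * ∑ i, ‖dev x i‖ ^ 2 :=
    mul_nonneg (div_nonneg (Finset.sum_nonneg fun _ _ => sq_nonneg _) (by linarith))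
      (Finset.sum_nonneg fun _ _ => sq_nonneg _)
  refine le_of_mul_le_mul_left ?_ (zero_lt_one.trans_le hn1)
  have hK' := le_mul_of_one_le_left hK hn1
  rw [mul_sub]
  linarith

lemma sum_norm_field_sq_le {L : Fin n → ℝ} (hL : ∀ i x y, ‖F i x - F i y‖ ≤ L i * ‖x - y‖)
    (xs : E d) (x : Fin n → E d) :
    ∑ i, ‖F i (x i)‖ ^ 2
      ≤ 2 * ∑ i, ‖F i xs‖ ^ 2 + 2 * (∑ i, L i ^ 2) * ∑ i, ‖x i - xs‖ ^ 2 := by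
  rw [Finset.mul_sum, Finset.mul_sum, ← Finset.sum_add_distrib]
  refine Finset.sum_le_sum fun i _ => ?_
  have h1 : ‖F i (x i)‖ ≤ ‖F i xs‖ + L i * ‖x i - xs‖ := by
    have := norm_add_le (F i xs) (F i (x i) - F i xs)
    rw [add_sub_cancel] at this
    linarith [hL i (x i) xs]
  have h2 : ‖F i (x i)‖ ^ 2 ≤ 2 * ‖F i xs‖ ^ 2 + 2 * (L i ^ 2 * ‖x i - xs‖ ^ 2) := by
    have := pow_le_pow_left₀ (norm_nonneg _) h1 2
    nlinarith [sq_nonneg (‖F i xs‖ - L i * ‖x i - xs‖)]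
  have h3 : L i ^ 2 * ‖x i - xs‖ ^ 2 ≤ (∑ i, L i ^ 2) * ‖x i - xs‖ ^ 2 := by
    gcongr
    exact Finset.single_le_sum (f := fun i => L i ^ 2) (fun _ _ => sq_nonneg _)
      (Finset.mem_univ i)
  linarith

lemma lyapunov_combine {μ c r S a α β q u u' D D' H G m : ℝ} (hμ : 0 < μ) (hc : 0 < c)
    (hr : 0 < r) (hS : 0 ≤ S) (ha : a = 4 * r * S / (μ * c) + 1) (hα : 0 < α) (hβ : 0 < β)
    (hαβ : α ≤ r * β) (hu : 0 ≤ u) (hD : 0 ≤ D) (hq : 0 ≤ q)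
    (hu' : u' ≤ (1 - α * μ) * u + α * S / μ * D + q * H)
    (hD' : D' ≤ (1 - c * β / 2) * D + 3 / c * q * H)
    (hH : H ≤ 2 * G + 2 * S * (m * (u + a * D))) :
    u' + a * D' ≤ (1 - min μ (c / (4 * r)) * α + (1 + 3 * a / c) * (2 * S * m) * q)
      * (u + a * D) + (1 + 3 * a / c) * (2 * G) * q := by
  set κ := min μ (c / (4 * r)) with hκ
  have ha0 : 0 ≤ 4 * r * S / (μ * c) := by positivity
  have ha1 : 0 ≤ a := by linarith
  have hκμ : κ * α ≤ α * μ := by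
    rw [mul_comm]; gcongr; exact min_le_left _ _
  have hκβ : κ * α ≤ c * β / 4 := by
    calc κ * α ≤ c / (4 * r) * (r * β) := by
          gcongr
          exact min_le_right _ _
      _ = c * β / 4 := by field_simp
  have haβ : α * S / μ ≤ a * (c * β / 4) := by
    calc α * S / μ ≤ (r * β) * S / μ := by gcongr
      _ = (4 * r * S / (μ * c)) * (c * β / 4) := by field_simp
      _ ≤ a * (c * β / 4) := by
        gcongr
        linarith
  have hcoef : α * S / μ + a * (1 - c * β / 2) ≤ a * (1 - κ * α) := by
    have := mul_le_mul_of_nonneg_left hκβ ha1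
    linarith
  have h1 := mul_le_mul_of_nonneg_left hD' ha1
  have h2 := mul_le_mul_of_nonneg_right hcoef hD
  have h3 := mul_le_mul_of_nonneg_right hκμ hu
  have e : a * (3 / c * q * H) = 3 * a / c * q * H := by ring
  have hfin : u' + a * D' ≤ (1 - κ * α) * (u + a * D) + (1 + 3 * a / c) * q * H := by
    linarith
  have hC : 0 ≤ (1 + 3 * a / c) * q := by positivity
  have := mul_le_mul_of_nonneg_left hH hC
  linarith

/-- Descent of the Lyapunov function along a noiseless step. -/
lemma lyapunov_drift_le {L : Fin n → ℝ} {μ r a : ℝ} (hn : n ≠ 0)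
    (hA : A ∈ doublyStochastic ℝ (Fin n)) (hσ : secondSingularValue A < 1) (hμ : 0 < μ)
    (hL : ∀ i x y, ‖F i x - F i y‖ ≤ L i * ‖x - y‖)
    (hmono : ∀ i x y, μ * ‖x - y‖ ^ 2 ≤ ⟪F i x - F i y, x - y⟫)
    {xs : E d} (hxs : ∑ i, F i xs = 0) (hr : 0 < r)
    (ha : a = 4 * r * (∑ i, L i ^ 2) / (μ * (1 - secondSingularValue A)) + 1)
    (hα : 0 < α) (hβ0 : 0 < β) (hβ1 : β < 1) (hαβ : α ≤ r * β) (x : Fin n → E d) :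
    lyapunov a xs (drift A F α β x)
      ≤ (1 - min μ ((1 - secondSingularValue A) / (4 * r)) * α
          + (1 + 3 * a / (1 - secondSingularValue A)) * (2 * (∑ i, L i ^ 2) * (n + 1))
            * (α ^ 2 / β)) * lyapunov a xs x
        + (1 + 3 * a / (1 - secondSingularValue A)) * (2 * ∑ i, ‖F i xs‖ ^ 2) * (α ^ 2 / β) := by
  have hD' := sum_norm_dev_drift_sq_le (F := F) (α := α) hn hA hσ hβ0 hβ1 x
  have hu' := le_inner_mean hn hμ hL hmono hxs x
  have hH := sum_norm_field_sq_le hL xs x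
  set c := 1 - secondSingularValue A with hc_def
  have hc : 0 < c := by linarith
  set S := ∑ i, L i ^ 2 with hS
  have hS0 : 0 ≤ S := by positivity
  have ha1 : 1 ≤ a := by
    have : 0 ≤ 4 * r * S / (μ * c) := by positivity
    linarith
  have hX := sum_norm_sub_sq_le_lyapunov hn ha1 xs x
  set G := ∑ i, ‖F i xs‖ ^ 2
  set H := ∑ i, ‖F i (x i)‖ ^ 2 with hH_def
  have hH0 : 0 ≤ H := by positivity
  set q := α ^ 2 / β with hq
  have hq0 : 0 ≤ q := by positivity
  have hαq : α ^ 2 ≤ q := by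
    rw [hq, le_div_iff₀ hβ0]
    nlinarith [sq_nonneg α]
  have hmeanF : ‖mean fun i => F i (x i)‖ ^ 2 ≤ H := by
    have h := sum_norm_sub_sq hn (fun i => F i (x i)) 0
    simp only [sub_zero] at h
    have h1 : 0 ≤ ∑ i, ‖dev (fun i => F i (x i)) i‖ ^ 2 := by positivity
    rw [hH_def, h]
    nlinarith [one_le_cast hn, sq_nonneg ‖mean fun i => F i (x i)‖]
  have hmean : ‖mean (drift A F α β x) - xs‖ ^ 2
      ≤ (1 - α * μ) * ‖mean x - xs‖ ^ 2 + α * S / μ * ∑ i, ‖dev x i‖ ^ 2 + q * H := by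
    rw [mean_drift hA, sub_right_comm, norm_sub_sq_real, inner_smul_right, norm_smul, mul_pow,
      Real.norm_eq_abs, sq_abs]
    have h1 := mul_le_mul_of_nonneg_left hu' (by linarith : 0 ≤ 2 * α)
    have h2 : α ^ 2 * ‖mean fun i => F i (x i)‖ ^ 2 ≤ q * H := by gcongr
    have e : 2 * α * (S / (2 * μ)) = α * S / μ := by field_simp
    have e' : 2 * α * (μ / 2 * ‖mean x - xs‖ ^ 2 - S / (2 * μ) * ∑ i, ‖dev x i‖ ^ 2)
        = α * μ * ‖mean x - xs‖ ^ 2 - α * S / μ * ∑ i, ‖dev x i‖ ^ 2 := by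
      rw [← e]; ring
    linarith
  have hH' : H ≤ 2 * G + 2 * S * ((n + 1) * lyapunov a xs x) := by
    have := mul_le_mul_of_nonneg_left hX (mul_nonneg zero_le_two hS0)
    linarith
  exact lyapunov_combine hμ hc hr hS0 ha hα hβ0 hαβ (sq_nonneg _)
    (Finset.sum_nonneg fun _ _ => sq_nonneg _) hq0 hmean hD' hH'

end Lyapunov

section StochasticStep

variable {Ω : Type*} {m mΩ : MeasurableSpace Ω} {P : Measure Ω} {n d : ℕ}

/-- `W` is a square integrable martingale increment with respect to `m`, with conditional second
moment at most `v`. -/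
structure IsIncrement (m : MeasurableSpace Ω) {mΩ : MeasurableSpace Ω} (P : Measure Ω)
    (W : Ω → E d) (v : ℝ) : Prop where
  memLp : MemLp W 2 P
  setIntegral_sq_le : ∀ S, MeasurableSet[m] S → ∫ ω in S, ‖W ω‖ ^ 2 ∂P ≤ v * P.real S
  setIntegral_inner : ∀ S, MeasurableSet[m] S → ∀ u : Ω → E d, Measurable[m] u → MemLp u 2 P →
    ∫ ω in S, ⟪u ω, W ω⟫ ∂P = 0

/-- A centred function of the present state and of independent fresh randomness is a martingale
increment. -/
lemma isIncrement_of_indep [IsProbabilityMeasure P] {𝓧 𝓔 : Type*} [MeasurableSpace 𝓧] [MeasurableSpace 𝓔] {X : Ω → 𝓧}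
    {η : Ω → 𝓔} {ψ : 𝓧 → 𝓔 → E d} {v : ℝ} (hm : m ≤ mΩ) (hX : Measurable[m] X)
    (hη : Measurable η) (hind : Indep m (MeasurableSpace.comap η inferInstance) P)
    (hψ : Measurable fun p : 𝓧 × 𝓔 => ψ p.1 p.2) (hL2 : ∀ x, MemLp (fun ω => ψ x (η ω)) 2 P)
    (h0 : ∀ x, ∫ ω, ψ x (η ω) ∂P = 0) (hv : ∀ x, ∫ ω, ‖ψ x (η ω)‖ ^ 2 ∂P ≤ v) :
    IsIncrement m P (fun ω => ψ (X ω) (η ω)) v := by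
  have hXm : Measurable X := hX.mono hm le_rfl
  have hWm : Measurable fun ω => ψ (X ω) (η ω) := hψ.comp (hXm.prodMk hη)
  have hv0 (x : 𝓧) : 0 ≤ v := (integral_nonneg fun _ => sq_nonneg _).trans (hv x)
  have hle (S : Set Ω) (hS : MeasurableSet[m] S) :
      ∫⁻ ω in S, ENNReal.ofReal (‖ψ (X ω) (η ω)‖ ^ 2) ∂P ≤ ENNReal.ofReal v * P S := by
    rw [setLIntegral_comp_of_indep (h := fun x e => ENNReal.ofReal (‖ψ x e‖ ^ 2)) hm hX hη hind hS
      ((hψ.norm.pow_const 2).ennreal_ofReal)]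
    calc _ ≤ ∫⁻ _ω in S, ENNReal.ofReal v ∂P := by
          refine lintegral_mono fun ω => ?_
          simp only []
          rw [← ofReal_integral_eq_lintegral_ofReal
            ((memLp_two_iff_integrable_sq_norm (hL2 _).aestronglyMeasurable).1 (hL2 _))
            (ae_of_all _ fun _ => sq_nonneg _)]
          exact ENNReal.ofReal_le_ofReal (hv _)
      _ = ENNReal.ofReal v * P S := by simp
  have hsq : Integrable (fun ω => ‖ψ (X ω) (η ω)‖ ^ 2) P := by
    refine ⟨(hWm.norm.pow_const 2).aestronglyMeasurable, ?_⟩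
    rw [hasFiniteIntegral_iff_ofReal (ae_of_all _ fun _ => sq_nonneg _)]
    have := hle Set.univ MeasurableSet.univ
    rw [setLIntegral_univ] at this
    exact this.trans_lt (by finiteness)
  have hmem : MemLp (fun ω => ψ (X ω) (η ω)) 2 P :=
    (memLp_two_iff_integrable_sq_norm hWm.aestronglyMeasurable).2 hsq
  refine ⟨hmem, fun S hS => ?_, fun S hS u hu hu2 => ?_⟩
  · obtain ⟨ω₀⟩ : Nonempty Ω := P.nonempty_of_neZero
    rw [integral_eq_lintegral_of_nonneg_ae (ae_of_all _ fun _ => sq_nonneg _)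
      (hWm.norm.pow_const 2).aestronglyMeasurable]
    refine (ENNReal.toReal_mono (by finiteness) (hle S hS)).trans_eq ?_
    rw [ENNReal.toReal_mul, ENNReal.toReal_ofReal (hv0 (X ω₀)), Measure.real]
  · have h := setIntegral_comp_of_indep (P := P) (X := fun ω => (X ω, u ω)) (η := η)
      (h := fun q e => ⟪q.2, ψ q.1 e⟫) hm (hX.prodMk hu) hη hind hS
      (Measurable.inner (measurable_snd.comp measurable_fst)
        (hψ.comp ((measurable_fst.comp measurable_fst).prodMk measurable_snd)))
      (integrable_inner_of_memLp hu2 hmem)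
    simp only [] at h
    rw [h]
    have e (ω : Ω) : ∫ ω', ⟪u ω, ψ (X ω) (η ω')⟫ ∂P = 0 := by
      rw [integral_inner ((hL2 (X ω)).integrable one_le_two), h0, inner_zero_right]
    simp [e]

lemma IsIncrement.add {W₁ W₂ : Ω → E d} {v₁ v₂ : ℝ} (h₁ : IsIncrement m P W₁ v₁)
    (h₂ : IsIncrement m P W₂ v₂) :
    IsIncrement m P (fun ω => W₁ ω + W₂ ω) (2 * (v₁ + v₂)) := by
  have hsq {W : Ω → E d} (h : MemLp W 2 P) : Integrable (fun ω => ‖W ω‖ ^ 2) P :=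
    (memLp_two_iff_integrable_sq_norm h.aestronglyMeasurable).1 h
  refine ⟨h₁.memLp.add h₂.memLp, fun S hS => ?_, fun S hS u hu hu2 => ?_⟩
  · calc ∫ ω in S, ‖W₁ ω + W₂ ω‖ ^ 2 ∂P
        ≤ ∫ ω in S, (2 * ‖W₁ ω‖ ^ 2 + 2 * ‖W₂ ω‖ ^ 2) ∂P := by
          refine integral_mono (hsq (h₁.memLp.add h₂.memLp)).integrableOn
            (((hsq h₁.memLp).const_mul 2).add ((hsq h₂.memLp).const_mul 2)).integrableOn
            fun ω => ?_
          have := parallelogram_law_with_norm ℝ (W₁ ω) (W₂ ω)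
          simp only []
          nlinarith [sq_nonneg ‖W₁ ω - W₂ ω‖]
      _ = 2 * ∫ ω in S, ‖W₁ ω‖ ^ 2 ∂P + 2 * ∫ ω in S, ‖W₂ ω‖ ^ 2 ∂P := by
          rw [integral_add ((hsq h₁.memLp).const_mul 2).integrableOn
            ((hsq h₂.memLp).const_mul 2).integrableOn, integral_const_mul, integral_const_mul]
      _ ≤ 2 * (v₁ + v₂) * P.real S := by
          linarith [h₁.setIntegral_sq_le S hS, h₂.setIntegral_sq_le S hS]
  · simp_rw [inner_add_right]
    rw [integral_add (integrable_inner_of_memLp hu2 h₁.memLp).integrableOn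
      (integrable_inner_of_memLp hu2 h₂.memLp).integrableOn,
      h₁.setIntegral_inner S hS u hu hu2, h₂.setIntegral_inner S hS u hu hu2, add_zero]

lemma continuous_mean : Continuous (mean : (Fin n → E d) → E d) := by
  unfold mean; fun_prop

lemma continuous_dev (i : Fin n) : Continuous fun x : Fin n → E d => dev x i := by
  have := continuous_mean (n := n) (d := d)
  unfold dev; fun_prop

lemma continuous_lyapunov (a : ℝ) (xs : E d) :
    Continuous (lyapunov a xs : (Fin n → E d) → ℝ) := by
  have := continuous_mean (n := n) (d := d)
  have := continuous_dev (n := n) (d := d)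
  unfold lyapunov; fun_prop

lemma continuous_lyapunovGrad (a : ℝ) (xs : E d) (i : Fin n) :
    Continuous fun x : Fin n → E d => lyapunovGrad a xs x i := by
  have := continuous_mean (n := n) (d := d)
  have := continuous_dev (n := n) (d := d) i
  unfold lyapunovGrad; fun_prop

lemma memLp_mean {Y : Ω → Fin n → E d} (hY : ∀ i, MemLp (fun ω => Y ω i) 2 P) :
    MemLp (fun ω => mean (Y ω)) 2 P := by
  unfold mean
  exact (memLp_finsetSum Finset.univ fun i _ => hY i).const_smul (n : ℝ)⁻¹

lemma memLp_dev {Y : Ω → Fin n → E d} (hY : ∀ i, MemLp (fun ω => Y ω i) 2 P) (i : Fin n) :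
    MemLp (fun ω => dev (Y ω) i) 2 P := by
  unfold dev
  exact (hY i).sub (memLp_mean hY)

lemma memLp_lyapunovGrad [IsFiniteMeasure P] {Y : Ω → Fin n → E d} (hY : ∀ i, MemLp (fun ω => Y ω i) 2 P) (a : ℝ)
    (xs : E d) (i : Fin n) : MemLp (fun ω => lyapunovGrad a xs (Y ω) i) 2 P := by
  unfold lyapunovGrad
  exact (((memLp_mean hY).sub (memLp_const xs)).const_smul (n : ℝ)⁻¹).add ((memLp_dev hY i).const_smul a)

lemma integrable_lyapunov [IsFiniteMeasure P] {Y : Ω → Fin n → E d} (hY : ∀ i, MemLp (fun ω => Y ω i) 2 P) (a : ℝ)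
    (xs : E d) : Integrable (fun ω => lyapunov a xs (Y ω)) P := by
  have hsq {W : Ω → E d} (h : MemLp W 2 P) : Integrable (fun ω => ‖W ω‖ ^ 2) P :=
    (memLp_two_iff_integrable_sq_norm h.aestronglyMeasurable).1 h
  exact (hsq ((memLp_mean hY).sub (memLp_const xs))).add
    ((integrable_finsetSum _ fun i _ => hsq (memLp_dev hY i)).const_mul a)

lemma setIntegral_lyapunov_sub_smul_le [IsFiniteMeasure P] (hn : n ≠ 0) {Y : Ω → Fin n → E d}
    {w : Fin n → Ω → E d} {a α v : ℝ} (ha : 1 ≤ a) (xs : E d) (hY : Measurable[m] Y)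
    (hY2 : ∀ i, MemLp (fun ω => Y ω i) 2 P) (hw : ∀ i, IsIncrement m P (w i) v)
    {S : Set Ω} (hS : MeasurableSet[m] S) :
    ∫ ω in S, lyapunov a xs (fun i => Y ω i - α • w i ω) ∂P
      ≤ ∫ ω in S, lyapunov a xs (Y ω) ∂P + α ^ 2 * (a * (n * v)) * P.real S := by
  have hinner (i) : Integrable (fun ω => ⟪lyapunovGrad a xs (Y ω) i, w i ω⟫) P :=
    integrable_inner_of_memLp (memLp_lyapunovGrad hY2 a xs i) (hw i).memLp
  have hV := integrable_lyapunov hY2 a xs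
  have hW := integrable_lyapunov (Y := fun ω i => w i ω) (fun i => (hw i).memLp) a 0
  have hsum : Integrable (fun ω => ∑ i, ⟪lyapunovGrad a xs (Y ω) i, w i ω⟫) P :=
    integrable_finsetSum _ fun i _ => hinner i
  simp_rw [lyapunov_sub_smul hn]
  have h0 (i) : ∫ ω in S, ⟪lyapunovGrad a xs (Y ω) i, w i ω⟫ ∂P = 0 :=
    (hw i).setIntegral_inner S hS _ ((continuous_lyapunovGrad a xs i).measurable.comp hY)
      (memLp_lyapunovGrad hY2 a xs i)
  have hVs : Integrable (fun ω => lyapunov a xs (Y ω)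
      - 2 * α * ∑ i, ⟪lyapunovGrad a xs (Y ω) i, w i ω⟫) P := hV.sub (hsum.const_mul _)
  rw [integral_add hVs.integrableOn (hW.const_mul _).integrableOn,
    integral_sub hV.integrableOn (hsum.const_mul _).integrableOn, integral_const_mul,
    integral_const_mul, integral_finsetSum _ fun i _ => (hinner i).integrableOn,
    Finset.sum_eq_zero fun i _ => h0 i, mul_zero, sub_zero]
  have hsq (i) : Integrable (fun ω => ‖w i ω‖ ^ 2) P :=
    (memLp_two_iff_integrable_sq_norm (hw i).memLp.aestronglyMeasurable).1 (hw i).memLp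
  have hfin : ∫ ω in S, lyapunov a 0 (fun i => w i ω) ∂P ≤ a * (n * v) * P.real S := by
    calc _ ≤ ∫ ω in S, a * ∑ i, ‖w i ω‖ ^ 2 ∂P :=
          integral_mono hW.integrableOn
            ((integrable_finsetSum _ fun i _ => hsq i).const_mul a).integrableOn
            fun ω => lyapunov_zero_le hn ha _
      _ = a * ∑ i, ∫ ω in S, ‖w i ω‖ ^ 2 ∂P := by
          rw [integral_const_mul, integral_finsetSum _ fun i _ => (hsq i).integrableOn]
      _ ≤ a * ∑ _i : Fin n, v * P.real S := by
          gcongr with i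
          exact (hw i).setIntegral_sq_le S hS
      _ = a * (n * v) * P.real S := by simp; ring
  have := mul_le_mul_of_nonneg_left hfin (sq_nonneg α)
  linarith

end StochasticStep

section Sampling

variable {Ω Ξ : Type*} {mΩ : MeasurableSpace Ω} [MeasurableSpace Ξ] {P : Measure Ω}
  [IsProbabilityMeasure P] {d γ : ℕ}

/-- The error of the averaged sampled gradient. -/
noncomputable def sampleError (γ : ℕ) (g : E d → Ξ → E d) (F : E d → E d) (x : E d)
    (s : Fin γ → Ξ) : E d :=
  (γ : ℝ)⁻¹ • ∑ l, (g x (s l) - F x)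

lemma measurable_sampleError {g : E d → Ξ → E d} {F : E d → E d}
    (hg : Measurable fun p : E d × Ξ => g p.1 p.2) (hF : Measurable F) :
    Measurable fun p : E d × (Fin γ → Ξ) => sampleError γ g F p.1 p.2 := by
  unfold sampleError
  have h1 (l : Fin γ) : Measurable fun p : E d × (Fin γ → Ξ) => g p.1 (p.2 l) :=
    hg.comp (measurable_fst.prodMk ((measurable_pi_apply l).comp measurable_snd))
  have h2 : Measurable fun p : E d × (Fin γ → Ξ) => F p.1 := hF.comp measurable_fst
  exact (Finset.measurable_fun_sum _ fun l _ => (h1 l).sub h2).const_smul (γ : ℝ)⁻¹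

lemma sampleError_moments (hγ : 0 < γ) {g : E d → Ξ → E d} {D : Measure Ξ} {v : ℝ}
    {F : E d → E d} {x : E d} (hg : Measurable (g x)) (hint : Integrable (g x) D)
    [IsProbabilityMeasure D] (hmean : ∫ s, g x s ∂D = F x)
    (hsq : Integrable (fun s => ‖g x s - F x‖ ^ 2) D) (hv : ∫ s, ‖g x s - F x‖ ^ 2 ∂D ≤ v)
    {ξ : Fin γ → Ω → Ξ} (hξ : ∀ l, Measurable (ξ l)) (hlaw : ∀ l, P.map (ξ l) = D)
    (hind : iIndepFun ξ P) :
    MemLp (fun ω => sampleError γ g F x fun l => ξ l ω) 2 P ∧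
      ∫ ω, sampleError γ g F x (fun l => ξ l ω) ∂P = 0 ∧
      ∫ ω, ‖sampleError γ g F x fun l => ξ l ω‖ ^ 2 ∂P ≤ v / γ := by
  have hgm : Measurable fun s => g x s - F x := hg.sub_const _
  have hYm (l) : Measurable fun ω => g x (ξ l ω) - F x := hgm.comp (hξ l)
  have hY2 (l) : MemLp (fun ω => g x (ξ l ω) - F x) 2 P := by
    rw [memLp_two_iff_integrable_sq_norm (hYm l).aestronglyMeasurable]
    rw [← hlaw l] at hsq
    exact hsq.comp_measurable (hξ l)
  have hY0 (l) : ∫ ω, (g x (ξ l ω) - F x) ∂P = 0 := by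
    have : ∫ s, (g x s - F x) ∂(P.map (ξ l)) = 0 := by
      rw [hlaw l, integral_sub hint (integrable_const _), hmean]; simp
    rwa [integral_map (hξ l).aemeasurable hgm.aestronglyMeasurable] at this
  have hYv (l) : ∫ ω, ‖g x (ξ l ω) - F x‖ ^ 2 ∂P ≤ v := by
    rw [← hlaw l, integral_map (hξ l).aemeasurable (hgm.norm.pow_const 2).aestronglyMeasurable]
      at hv
    exact hv
  unfold sampleError
  refine ⟨(memLp_finsetSum Finset.univ fun l _ => hY2 l).const_smul (γ : ℝ)⁻¹, ?_, ?_⟩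
  · rw [integral_smul, integral_finsetSum _ fun l _ => (hY2 l).integrable one_le_two]
    simp [hY0]
  · exact integral_norm_average_sq_le hγ
      (fun l l' hll => (hind.indepFun hll).comp hgm hgm) hY2 hY0 hYv

end Sampling

section Information

variable {n d : ℕ} {Ω : Type*} {mΩ : MeasurableSpace Ω} {Ξ : Fin n → Type*}
  [∀ i, MeasurableSpace (Ξ i)] {γ : ℕ → ℕ}

/-- The σ-algebras generated by the samples of each iteration and by each noise vector. -/
abbrev sourceAlgebra (ξ : ∀ (i : Fin n) (k : ℕ), Fin (γ k) → Ω → Ξ i) (N : Fin n → ℕ → Ω → E d) :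
    ℕ ⊕ (Fin n × ℕ) → MeasurableSpace Ω :=
  Sum.elim (fun k => MeasurableSpace.comap (fun ω i l => ξ i k l ω) inferInstance)
    fun p => MeasurableSpace.comap (N p.1 p.2) inferInstance

/-- The σ-algebra of everything sampled before iteration `k`. -/
abbrev pastAlgebra (ξ : ∀ (i : Fin n) (k : ℕ), Fin (γ k) → Ω → Ξ i) (N : Fin n → ℕ → Ω → E d)
    (k : ℕ) : MeasurableSpace Ω :=
  ⨆ s ∈ {s : ℕ ⊕ (Fin n × ℕ) | Sum.elim id Prod.snd s < k}, sourceAlgebra ξ N s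

variable {ξ : ∀ (i : Fin n) (k : ℕ), Fin (γ k) → Ω → Ξ i} {N : Fin n → ℕ → Ω → E d}

lemma pastAlgebra_mono : Monotone (pastAlgebra ξ N) := fun _ _ hkl =>
  biSup_mono fun _ hs => lt_of_lt_of_le hs hkl

lemma sourceAlgebra_le_pastAlgebra {s : ℕ ⊕ (Fin n × ℕ)} {k : ℕ}
    (hs : Sum.elim id Prod.snd s < k) : sourceAlgebra ξ N s ≤ pastAlgebra ξ N k :=
  le_biSup (sourceAlgebra ξ N) hs

lemma measurable_samples_past (k : ℕ) :
    Measurable[pastAlgebra ξ N (k + 1)] fun ω i l => ξ i k l ω :=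
  Measurable.mono (comap_measurable _)
    (sourceAlgebra_le_pastAlgebra (s := Sum.inl k) (Nat.lt_succ_self k)) le_rfl

lemma measurable_sample_past (i : Fin n) (k : ℕ) (l : Fin (γ k)) :
    Measurable[pastAlgebra ξ N (k + 1)] (ξ i k l) := by
  have h := measurable_samples_past (ξ := ξ) (N := N) k
  have h1 : Measurable fun q : ∀ i, Fin (γ k) → Ξ i => q i l := by fun_prop
  exact h1.comp h

lemma measurable_noise_past (i : Fin n) (k : ℕ) : Measurable[pastAlgebra ξ N (k + 1)] (N i k) :=
  Measurable.mono (comap_measurable _)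
    (sourceAlgebra_le_pastAlgebra (s := Sum.inr (i, k)) (Nat.lt_succ_self k)) le_rfl

variable {P : Measure Ω} {D : ∀ i, Measure (Ξ i)} {σ : ℕ → ℝ}

lemma SamplesAndNoise.sourceAlgebra_le (h : SamplesAndNoise P D σ γ ξ N)
    (s : ℕ ⊕ (Fin n × ℕ)) : sourceAlgebra ξ N s ≤ mΩ := by
  rcases s with k | p
  · refine Measurable.comap_le (measurable_pi_lambda _ fun i => measurable_pi_lambda _ fun l => ?_)
    exact h.sample_measurable i k l
  · exact (h.noise_measurable p.1 p.2).comap_le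

lemma SamplesAndNoise.iIndep_sourceAlgebra (h : SamplesAndNoise P D σ γ ξ N) :
    iIndep (sourceAlgebra ξ N) P := by
  refine iIndep_sumElim h.sample_indep_time h.noise_indep h.sample_indep_noise
    (fun k => ?_) fun p => ?_
  · have : Measurable fun (q : ∀ (i : Fin n) (k : ℕ), Fin (γ k) → Ξ i) i l => q i k l := by
      fun_prop
    exact Measurable.comap_le (m₁ := MeasurableSpace.comap _ _) (this.comp (comap_measurable _))
  · have : Measurable fun (q : Fin n → ℕ → E d) => q p.1 p.2 := by fun_prop
    exact Measurable.comap_le (m₁ := MeasurableSpace.comap _ _) (this.comp (comap_measurable _))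

lemma SamplesAndNoise.pastAlgebra_le (h : SamplesAndNoise P D σ γ ξ N) (k : ℕ) :
    pastAlgebra ξ N k ≤ mΩ :=
  iSup₂_le fun s _ => h.sourceAlgebra_le s

lemma SamplesAndNoise.indep_past (h : SamplesAndNoise P D σ γ ξ N) {s : ℕ ⊕ (Fin n × ℕ)} {k : ℕ}
    (hs : Sum.elim id Prod.snd s = k) : Indep (pastAlgebra ξ N k) (sourceAlgebra ξ N s) P := by
  have := indep_iSup_of_disjoint h.sourceAlgebra_le h.iIndep_sourceAlgebra
    (S := {s | Sum.elim id Prod.snd s < k}) (T := {s})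
    (Set.disjoint_singleton_right.2 fun hlt => (hs ▸ hlt : Sum.elim id Prod.snd s < _).ne hs)
  rwa [iSup_singleton] at this

/-- The filtration of the past of the algorithm. -/
def SamplesAndNoise.filtration (h : SamplesAndNoise P D σ γ ξ N) : Filtration ℕ mΩ where
  seq := pastAlgebra ξ N
  mono' := pastAlgebra_mono
  le' := h.pastAlgebra_le

lemma SamplesAndNoise.isIncrement_noise [IsProbabilityMeasure P]
    (h : SamplesAndNoise P D σ γ ξ N) {i : Fin n} {k : ℕ} (hσ : 0 < σ k) :
    IsIncrement (pastAlgebra ξ N k) P (N i k) (2 * d * σ k ^ 2) := by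
  have hm := h.noise_measurable i k
  have hlaw := h.noise_law i k
  exact isIncrement_of_indep (X := fun _ => ()) (η := N i k) (ψ := fun _ e => e)
    (h.pastAlgebra_le k) measurable_const hm
    (h.indep_past (s := Sum.inr (i, k)) rfl) measurable_snd
    (fun _ => (memLp_of_laplace hσ hm hlaw).1) (fun _ => integral_eq_zero_of_laplace hσ hm hlaw)
    fun _ => (memLp_of_laplace hσ hm hlaw).2.le

lemma SamplesAndNoise.isIncrement_sampleError [IsProbabilityMeasure P]
    [∀ i, IsProbabilityMeasure (D i)] (h : SamplesAndNoise P D σ γ ξ N)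
    {g : ∀ i, E d → Ξ i → E d} {f : Fin n → E d → ℝ} {σg : ℝ}
    (hg : UnbiasedBoundedVariance g D f σg) {i : Fin n} (hf : Measurable (∇ (f i))) {k : ℕ}
    (hγ : 0 < γ k) {X : Ω → E d} (hX : Measurable[pastAlgebra ξ N k] X) :
    IsIncrement (pastAlgebra ξ N k) P
      (fun ω => sampleError (γ k) (g i) (∇ (f i)) (X ω) fun l => ξ i k l ω) (σg ^ 2 / γ k) := by
  have hgm (x : E d) : Measurable (g i x) := (hg.measurable i).comp measurable_prodMk_left
  have hmom (x : E d) := sampleError_moments (P := P) hγ (hgm x) (hg.integrable i x)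
    (hg.unbiased i x) (hg.integrable_sq i x) (hg.variance_le i x) (h.sample_measurable i k)
    (h.sample_law i k) (h.sample_indep_within i k)
  have hle : MeasurableSpace.comap (fun ω l => ξ i k l ω) inferInstance
      ≤ sourceAlgebra ξ N (Sum.inl k) := by
    refine Measurable.comap_le (m₁ := MeasurableSpace.comap _ _) ?_
    exact (measurable_pi_apply (X := fun i => Fin (γ k) → Ξ i) i).comp (comap_measurable _)
  exact isIncrement_of_indep (h.pastAlgebra_le k) hX
    (measurable_pi_lambda _ fun l => h.sample_measurable i k l)
    (indep_of_indep_of_le_right (h.indep_past (s := Sum.inl k) rfl) hle)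
    (measurable_sampleError (hg.measurable i) hf) (fun x => (hmom x).1) (fun x => (hmom x).2.1)
    fun x => (hmom x).2.2

end Information

section Iterates

variable {n d : ℕ} {Ω : Type*} {Ξ : Fin n → Type*} {γ : ℕ → ℕ}
  {G : SimpleGraph (Fin n)} {A : Matrix (Fin n) (Fin n) ℝ} {g : ∀ i, E d → Ξ i → E d}
  {α β : ℕ → ℝ} {x₀ : Fin n → E d} {ξ : ∀ (i : Fin n) (k : ℕ), Fin (γ k) → Ω → Ξ i}
  {N : Fin n → ℕ → Ω → E d}

/-- The iteration is a noiseless step perturbed by sampling errors and privacy noise. -/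
lemma iterate_succ_eq (hA : ∀ i j, j ∉ nbhd G i → A i j = 0) (F : Fin n → E d → E d) {k : ℕ}
    (hγ : 0 < γ k) (i : Fin n) (ω : Ω) :
    iterate G A g α β γ x₀ ξ N (k + 1) i ω
      = drift A F (α k) (β k) (fun j => iterate G A g α β γ x₀ ξ N k j ω) i
        - α k • (sampleError (γ k) (g i) (F i) (iterate G A g α β γ x₀ ξ N k i ω)
          (fun l => ξ i k l ω) + N i k ω) := by
  have hsum : ∑ j ∈ nbhd G i, A i j • iterate G A g α β γ x₀ ξ N k j ω
      = ∑ j, A i j • iterate G A g α β γ x₀ ξ N k j ω :=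
    Finset.sum_subset (Finset.subset_univ _) fun j _ hj => by rw [hA i j hj, zero_smul]
  have hγ0 : (γ k : ℝ) ≠ 0 := by positivity
  rw [iterate, hsum, drift, sampleError, Finset.sum_sub_distrib, Finset.sum_const,
    Finset.card_univ, Fintype.card_fin, ← Nat.cast_smul_eq_nsmul ℝ, smul_sub, smul_smul,
    inv_mul_cancel₀ hγ0]
  module

lemma measurable_iterate_succ {m₀ : MeasurableSpace Ω} [∀ i, MeasurableSpace (Ξ i)]
    (hg : ∀ i, Measurable fun p : E d × Ξ i => g i p.1 p.2) {k : ℕ}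
    (hX : ∀ i, Measurable (iterate G A g α β γ x₀ ξ N k i))
    (hξ : ∀ i l, Measurable (ξ i k l)) (hN : ∀ i, Measurable (N i k)) (i : Fin n) :
    Measurable (iterate G A g α β γ x₀ ξ N (k + 1) i) := by
  have h1 (l) : Measurable fun ω => g i (iterate G A g α β γ x₀ ξ N k i ω) (ξ i k l ω) :=
    (hg i).comp ((hX i).prodMk (hξ i l))
  have hNi := hN i
  have h2 : Measurable fun ω => ∑ j ∈ nbhd G i, A i j • iterate G A g α β γ x₀ ξ N k j ω :=
    Finset.measurable_fun_sum _ fun j _ => (hX j).const_smul (A i j)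
  have h3 : Measurable fun ω => ∑ l, g i (iterate G A g α β γ x₀ ξ N k i ω) (ξ i k l ω) :=
    Finset.measurable_fun_sum _ fun l _ => h1 l
  exact (((hX i).const_smul (1 - β k)).add (h2.const_smul (β k))).sub
    (((h3.const_smul (γ k : ℝ)⁻¹).add hNi).const_smul (α k))

variable {mΩ : MeasurableSpace Ω} [∀ i, MeasurableSpace (Ξ i)] {P : Measure Ω}

lemma measurable_iterate_past (hg : ∀ i, Measurable fun p : E d × Ξ i => g i p.1 p.2)
    (k : ℕ) (i : Fin n) :
    Measurable[pastAlgebra ξ N k] (iterate G A g α β γ x₀ ξ N k i) := by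
  induction k generalizing i with
  | zero => exact @measurable_const _ _ _ (pastAlgebra ξ N 0) (x₀ i)
  | succ k ih =>
    have h0 (j) : Measurable[pastAlgebra ξ N (k + 1)] (iterate G A g α β γ x₀ ξ N k j) :=
      (ih j).mono (pastAlgebra_mono (Nat.le_succ k)) le_rfl
    have h1 (j) (l : Fin (γ k)) : Measurable[pastAlgebra ξ N (k + 1)] (ξ j k l) :=
      measurable_sample_past j k l
    have h2 (j) : Measurable[pastAlgebra ξ N (k + 1)] (N j k) := measurable_noise_past j k
    exact measurable_iterate_succ (G := G) (A := A) (α := α) (β := β) (x₀ := x₀)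
      hg h0 h1 h2 i

lemma continuous_of_lipschitz {h : E d → E d} {M : ℝ} (hL : ∀ x y, ‖h x - h y‖ ≤ M * ‖x - y‖) :
    Continuous h := by
  refine LipschitzWith.continuous (K := M.toNNReal) (LipschitzWith.of_dist_le_mul fun x y => ?_)
  rw [dist_eq_norm, dist_eq_norm]
  exact (hL x y).trans (mul_le_mul_of_nonneg_right (Real.le_coe_toNNReal M) (norm_nonneg _))

lemma memLp_comp_of_lipschitz [IsFiniteMeasure P] {h : E d → E d} {M : ℝ}
    (hL : ∀ x y, ‖h x - h y‖ ≤ M * ‖x - y‖) {X : Ω → E d} (hX : MemLp X 2 P) :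
    MemLp (fun ω => h (X ω)) 2 P := by
  have h1 : MemLp (fun ω => ‖h 0‖ + M * ‖X ω‖) 2 P :=
    (memLp_const ‖h 0‖).add (hX.norm.const_mul M)
  refine h1.of_le ((continuous_of_lipschitz hL).comp_aestronglyMeasurable hX.aestronglyMeasurable)
    (ae_of_all _ fun ω => ?_)
  have h2 := hL (X ω) 0
  have h3 := norm_add_le (h 0) (h (X ω) - h 0)
  rw [add_sub_cancel] at h3
  rw [sub_zero] at h2
  exact (h3.trans (by linarith)).trans (le_abs_self _)

lemma continuous_drift {F : Fin n → E d → E d} (hF : ∀ i, Continuous (F i)) (a b : ℝ) :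
    Continuous (drift A F a b) := by
  refine continuous_pi fun i => ?_
  have := hF i
  unfold drift
  fun_prop

lemma memLp_drift [IsFiniteMeasure P] {F : Fin n → E d → E d} {L : Fin n → ℝ}
    (hL : ∀ i x y, ‖F i x - F i y‖ ≤ L i * ‖x - y‖) (a b : ℝ) {X : Fin n → Ω → E d}
    (hX : ∀ i, MemLp (X i) 2 P) (i : Fin n) :
    MemLp (fun ω => drift A F a b (fun j => X j ω) i) 2 P := by
  unfold drift
  exact (((hX i).const_smul (1 - b)).add
    ((memLp_finsetSum Finset.univ fun j _ => (hX j).const_smul (A i j)).const_smul b)).sub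
    ((memLp_comp_of_lipschitz (hL i) (hX i)).const_smul a)

end Iterates

section Minimizer

variable {n d : ℕ} {f : Fin n → E d → ℝ} {L : Fin n → ℝ} {μ : ℝ}

lemma SmoothStronglyConvex.exists_sum_gradient_eq_zero (hf : SmoothStronglyConvex f L μ)
    (hn : n ≠ 0) : ∃ x, ∑ i, ∇ (f i) x = 0 := by
  have : Nonempty (Fin n) := ⟨⟨0, Nat.pos_of_ne_zero hn⟩⟩
  refine exists_zero_of_lipschitz_stronglyMonotone (h := fun x => ∑ i, ∇ (f i) x)
    (M := ∑ i, L i) (μ := n * μ)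
    (Finset.sum_pos (fun i _ => hf.lipschitz_pos i) Finset.univ_nonempty)
    (mul_pos (by positivity) hf.convexity_pos) (fun x y => ?_) fun x y => ?_
  · rw [← Finset.sum_sub_distrib, Finset.sum_mul]
    exact norm_sum_le_of_le _ fun i _ => hf.lipschitz i x y
  · rw [← Finset.sum_sub_distrib, sum_inner]
    calc n * μ * ‖x - y‖ ^ 2 = ∑ _i : Fin n, μ * ‖x - y‖ ^ 2 := by simp; ring
      _ ≤ _ := Finset.sum_le_sum fun i _ => hf.strongly_convex i x y

lemma SmoothStronglyConvex.sum_le_of_sum_gradient_eq_zero (hf : SmoothStronglyConvex f L μ)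
    {x : E d} (hx : ∑ i, ∇ (f i) x = 0) (y : E d) : ∑ i, f i x ≤ ∑ i, f i y := by
  refine le_of_gradient_monotone_of_eq_zero (f := fun x => ∑ i, f i x)
    (f' := fun x => ∑ i, ∇ (f i) x) (fun x => ?_) (fun x y => ?_) hx y
  · rw [hasGradientAt_iff_hasFDerivAt, map_sum]
    exact HasFDerivAt.fun_sum fun i _ => (hf.differentiable i x).hasGradientAt.hasFDerivAt
  · rw [← Finset.sum_sub_distrib, sum_inner]
    exact Finset.sum_nonneg fun i _ => le_trans
      (mul_nonneg hf.convexity_pos.le (sq_nonneg _)) (hf.strongly_convex i x y)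

end Minimizer

end GradPerturb

open GradPerturb
theorem theorem6 {n d : ℕ} {Ω : Type*} [MeasurableSpace Ω] (P : Measure Ω) [IsProbabilityMeasure P]
    {Ξ : Fin n → Type*} [∀ i, MeasurableSpace (Ξ i)]
    -- data distributions, cost functions and sampled gradients
    (D : ∀ i, Measure (Ξ i)) [∀ i, IsProbabilityMeasure (D i)]
    (ℓ : ∀ i, E d → Ξ i → ℝ) (hℓ : ∀ i x, Integrable (ℓ i x) (D i))
    (g : ∀ i, E d → Ξ i → E d)
    (L : Fin n → ℝ) (μ σg : ℝ)
    (hf : SmoothStronglyConvex (localCost ℓ D) L μ)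
    (hg : UnbiasedBoundedVariance g D (localCost ℓ D) σg)
    -- communication network
    (G : SimpleGraph (Fin n)) (A : Matrix (Fin n) (Fin n) ℝ)
    (hA : ConnectedDoublyStochastic G A)
    -- step sizes, noise parameters, sample sizes
    (α β σ : ℕ → ℝ) (γ : ℕ → ℕ)
    (hpar : AdmissibleParameters α β σ γ)
    (hstep : StepSizeConditions n (secondSingularValue A) μ (∑ i, L i ^ 2) α β σ γ)
    (hdiv : Tendsto (fun K : ℕ => ∑ k ∈ Finset.range K, α k) atTop atTop)
    -- initial values, samples and privacy noise
    (x₀ : Fin n → E d)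
    (ξ : ∀ (i : Fin n) (k : ℕ), Fin (γ k) → Ω → Ξ i) (N : Fin n → ℕ → Ω → E d)
    (hrand : SamplesAndNoise P D σ γ ξ N) :
    ∃ xstar : E d, (∀ y, globalCost ℓ D xstar ≤ globalCost ℓ D y) ∧
      ∀ i,
        ((∀ k, MemLp (iterate G A g α β γ x₀ ξ N k i) 2 P) ∧
          Tendsto (fun k => ∫ ω, ‖iterate G A g α β γ x₀ ξ N k i ω - xstar‖ ^ 2 ∂P)
            atTop (𝓝 0)) ∧
        ∀ᵐ ω ∂P, Tendsto (fun k => iterate G A g α β γ x₀ ξ N k i ω) atTop (𝓝 xstar) := by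
  have hn : n ≠ 0 := by
    rintro rfl
    obtain ⟨i⟩ := hA.connected.nonempty
    exact i.elim0
  obtain ⟨xs, hxs⟩ := hf.exists_sum_gradient_eq_zero hn
  refine ⟨xs, fun y => hf.sum_le_of_sum_gradient_eq_zero hxs y, ?_⟩
  have hμ := hf.convexity_pos
  obtain ⟨ζ, -, hζ⟩ := hA.weights
  have hA0 (i j) (hj : j ∉ nbhd G i) : A i j = 0 := (hζ i j).2 hj
  set F : Fin n → E d → E d := fun i => ∇ (localCost ℓ D i)
  have hFc (i) : Continuous (F i) := continuous_of_lipschitz (hf.lipschitz i)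
  set X := iterate G A g α β γ x₀ ξ N with hX
  set w : ℕ → Fin n → Ω → E d := fun k i ω =>
    sampleError (γ k) (g i) (F i) (X k i ω) (fun l => ξ i k l ω) + N i k ω with hw
  have hXsucc (k i ω) : X (k + 1) i ω
      = drift A F (α k) (β k) (fun j => X k j ω) i - α k • w k i ω :=
    iterate_succ_eq hA0 F (hpar.sample_pos k) i ω
  have hXm (k i) : Measurable[pastAlgebra ξ N k] (X k i) :=
    measurable_iterate_past hg.measurable k i
  have hXpi (k) : Measurable[pastAlgebra ξ N k] fun ω i => X k i ω :=
    @measurable_pi_lambda Ω (Fin n) (fun _ => E d) (pastAlgebra ξ N k) _ _ (hXm k)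
  have hinc (k i) : IsIncrement (pastAlgebra ξ N k) P (w k i)
      (2 * (σg ^ 2 / γ k + 2 * d * σ k ^ 2)) :=
    (hrand.isIncrement_sampleError hg (hFc i).measurable (hpar.sample_pos k) (hXm k i)).add
      (hrand.isIncrement_noise (hpar.noise_pos k))
  have hX2 (k) : ∀ i, MemLp (X k i) 2 P := by
    induction k with
    | zero => exact fun i => memLp_const (x₀ i)
    | succ k ih =>
      intro i
      have e : X (k + 1) i = fun ω =>
          drift A F (α k) (β k) (fun j => X k j ω) i - α k • w k i ω := funext (hXsucc k i)
      rw [e]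
      exact (memLp_drift hf.lipschitz _ _ ih i).sub ((hinc k i).memLp.const_smul (α k))
  set r : ℝ := min (2 * (1 - secondSingularValue A) / (3 * μ))
      ((1 - secondSingularValue A) ^ 2 * μ ^ 2 * β 0 /
        (16 * (6 * (∑ i, L i ^ 2) * α 0 + n * (1 - secondSingularValue A) * μ * β 0) *
          (β 0 + 1) * (∑ i, L i ^ 2))) with hr
  have hr0 : 0 < r :=
    (div_pos (hpar.step_pos 0) (hpar.weight_mem 0).1).trans_le (hstep.ratio_le 0)
  have hσ : secondSingularValue A < 1 := by
    have h1 : 0 < 2 * (1 - secondSingularValue A) / (3 * μ) := hr0.trans_le (min_le_left _ _)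
    have h2 := (div_pos_iff_of_pos_right (by positivity)).1 h1
    linarith
  have hαβ (k) : α k ≤ r * β k := (div_le_iff₀ (hpar.weight_mem k).1).1 (hstep.ratio_le k)
  set c : ℝ := 1 - secondSingularValue A with hc
  have hc0 : 0 < c := by linarith
  set a : ℝ := 4 * r * (∑ i, L i ^ 2) / (μ * c) + 1 with ha
  have hL0 : 0 ≤ ∑ i, L i ^ 2 := Finset.sum_nonneg fun _ _ => sq_nonneg _
  have ha1 : 1 ≤ a := by
    have : 0 ≤ 4 * r * (∑ i, L i ^ 2) / (μ * c) := by positivity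
    linarith
  have ha0 : 0 ≤ a := zero_le_one.trans ha1
  set κ : ℝ := min μ (c / (4 * r)) with hκ
  have hκ0 : 0 < κ := lt_min hμ (by positivity)
  set C₁ : ℝ := (1 + 3 * a / c) * (2 * (∑ i, L i ^ 2) * (n + 1)) with hC₁
  set C₂ : ℝ := (1 + 3 * a / c) * (2 * ∑ i, ‖F i xs‖ ^ 2) with hC₂
  have hC₁0 : 0 ≤ C₁ := by positivity
  have hC₂0 : 0 ≤ C₂ := by positivity
  have hq0 (k) : 0 ≤ α k ^ 2 / β k := div_nonneg (sq_nonneg _) (hpar.weight_mem k).1.le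
  set t : ℕ → ℝ := fun k => C₂ * (α k ^ 2 / β k)
    + α k ^ 2 * (a * (n * (2 * (σg ^ 2 / γ k + 2 * d * σ k ^ 2)))) with ht
  have ht0 (k) : 0 ≤ t k := add_nonneg (mul_nonneg hC₂0 (hq0 k)) (by positivity)
  have hts : Summable t := by
    refine (hstep.summable_ratio.mul_left C₂).add ?_
    refine ((hstep.summable_sample.mul_left (2 * a * n * σg ^ 2)).add
      (hstep.summable_noise.mul_left (4 * a * n * d))).congr fun k => ?_
    ring
  have hVint (k) : Integrable (fun ω => lyapunov a xs fun i => X k i ω) P :=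
    integrable_lyapunov (hX2 k) a xs
  have hconv := tendsto_zero_of_setIntegral_le (P := P) hrand.filtration
    (V := fun k ω => lyapunov a xs fun i => X k i ω) (α := α)
    (s := fun k => C₁ * (α k ^ 2 / β k)) (t := t) hκ0
    (fun k => Measurable.stronglyMeasurable
      ((continuous_lyapunov a xs).measurable.comp (hXpi k)))
    hVint (fun k ω => lyapunov_nonneg ha0 _ _) (fun k => (hpar.step_pos k).le)
    (fun k => mul_nonneg hC₁0 (hq0 k)) (hstep.summable_ratio.mul_left C₁) ht0 hts hdiv
    fun k S hS => by
      have hYm : Measurable[pastAlgebra ξ N k] fun ω => drift A F (α k) (β k) fun j => X k j ω :=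
        (continuous_drift hFc _ _).measurable.comp (hXpi k)
      have hY2 (i) : MemLp (fun ω => drift A F (α k) (β k) (fun j => X k j ω) i) 2 P :=
        memLp_drift hf.lipschitz _ _ (hX2 k) i
      have h1 := setIntegral_lyapunov_sub_smul_le (α := α k) hn ha1 xs hYm hY2 (hinc k) hS
      have h2 : ∫ ω in S, lyapunov a xs (drift A F (α k) (β k) fun j => X k j ω) ∂P
          ≤ ∫ ω in S, ((1 - κ * α k + C₁ * (α k ^ 2 / β k)) * (lyapunov a xs fun i => X k i ω)
            + C₂ * (α k ^ 2 / β k)) ∂P :=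
        integral_mono (integrable_lyapunov hY2 a xs).integrableOn
          (((hVint k).const_mul _).add (integrable_const _)).integrableOn fun ω =>
          lyapunov_drift_le hn hA.doubly_stochastic hσ hμ hf.lipschitz hf.strongly_convex hxs hr0
            rfl (hpar.step_pos k) (hpar.weight_mem k).1 (hpar.weight_mem k).2 (hαβ k) _
      rw [integral_add ((hVint k).const_mul _).integrableOn (integrable_const _),
        integral_const_mul, setIntegral_const, smul_eq_mul] at h2
      simp only [hXsucc, ht]
      linarith
  intro i
  have hle (k ω) : ‖X k i ω - xs‖ ^ 2 ≤ 2 * lyapunov a xs fun i => X k i ω :=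
    norm_sub_sq_le_lyapunov ha1 xs (fun i => X k i ω) i
  have hd (k) : MemLp (fun ω => X k i ω - xs) 2 P := (hX2 k i).sub (memLp_const xs)
  have hmean (k) : ∫ ω, ‖X k i ω - xs‖ ^ 2 ∂P
      ≤ 2 * ∫ ω, (lyapunov a xs fun i => X k i ω) ∂P := by
    rw [← integral_const_mul]
    exact integral_mono ((memLp_two_iff_integrable_sq_norm (hd k).aestronglyMeasurable).1 (hd k))
      ((hVint k).const_mul 2) fun ω => hle k ω
  have hlim := hconv.1.const_mul 2
  rw [mul_zero] at hlim
  refine ⟨⟨fun k => hX2 k i, squeeze_zero (fun k => integral_nonneg fun ω => sq_nonneg _)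
    hmean hlim⟩, ?_⟩
  filter_upwards [hconv.2] with ω hω
  have hω2 := hω.const_mul 2
  rw [mul_zero] at hω2
  have h2 : Tendsto (fun k => ‖X k i ω - xs‖ ^ 2) atTop (𝓝 0) :=
    squeeze_zero (fun k => sq_nonneg _) (fun k => hle k ω) hω2
  rw [tendsto_iff_norm_sub_tendsto_zero]
  simpa using h2.sqrt
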